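/- Let $r\ge 0$ and let $F$ be the free group with basis $A=\{a_1,\dots,a_r\}$. For $g\in F$ let $|g|$ be the least length of a word in $A\cup A^{-1}$ representing $g$, and let $d(g,h)=|g^{-1}h|$ be the word metric. Then there is a deterministic algorithm (depending only on $r$) and a polynomial $p$ such that the following holds. The input is a pair of finite lists $(u_1,\dots,u_m)$ and $(v_1,\dots,v_n)$ of (not necessarily reduced) words in $A\cup A^{-1}$; let $H=\langle u_1,\dots,u_m\rangle$ and $K=\langle v_1,\dots,v_n\rangle$ be the subgroups of $F$ that they generate. The algorithm halts after at most $p(N)$ steps, where $N=m+n+\sum_i|u_i|+\sum_j|v_j|$ with $|u_i|,|v_j|$ the lengths of these words. If $H$ and $K$ are not both trivial, it outputs words representing elements $h\in H$ and $k\in K$, not both trivial, such that $d(h,k)\le d(h',k')$ for all $h'\in H$ and $k'\in K$ that are not both trivial; if $H$ and $K$ are both trivial, it reports that no such pair exists. (Algorithms are formalized as while-programs on binary trees in which each operation is charged the sizes of the trees it handles, a model polynomially equivalent to Turing machines.) -/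

import Mathlib

/-! ### The machine model: while-programs on binary trees

Programs act on finitely many variables (those they mention) that hold finite binary trees, and
use the LISP-like operations `nil`, `cons`, `hd`, `tl`, an equality test, assignment, composition,
branching and while-loops. Every evaluation of an expression is charged the total size of the
trees that occur as values of its subexpressions, in addition to one unit per executed command.
So there is no free sharing or copying of data: within `t` units of time the total size of the
store grows by at most `t`, and a multitape Turing machine that keeps the variables as serialized
trees simulates the program in time polynomial in `t` and in the size of the input. Conversely a
Turing machine with its tapes kept as pairs of lists is simulated with polynomial overhead.
Polynomial time in this model is thus the usual polynomial time. -/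

namespace TreeWhile

/-- Finite binary trees, the data of the programs. -/
inductive Data : Type
  | nil : Data
  | cons : Data → Data → Data
  deriving DecidableEq

/-- The number of nodes of a tree, leaves included. -/
def Data.size : Data → ℕ
  | .nil => 1
  | .cons a b => a.size + b.size + 1

/-- The left subtree (`nil` for `nil`). -/
def Data.hd : Data → Data
  | .nil => .nil
  | .cons a _ => a

/-- The right subtree (`nil` for `nil`). -/
def Data.tl : Data → Data
  | .nil => .nil
  | .cons _ b => b

/-- Truth values: `nil` is false, every other tree counts as true. -/
def Data.ofBool : Bool → Data
  | false => .nil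
  | true => .cons .nil .nil

/-- A store assigns a tree to each variable. -/
abbrev Store : Type := ℕ → Data

inductive Expr : Type
  | var : ℕ → Expr
  | nil : Expr
  | cons : Expr → Expr → Expr
  | hd : Expr → Expr
  | tl : Expr → Expr
  | eq : Expr → Expr → Expr

def Expr.eval (s : Store) : Expr → Data
  | .var x => s x
  | .nil => .nil
  | .cons e f => .cons (e.eval s) (f.eval s)
  | .hd e => (e.eval s).hd
  | .tl e => (e.eval s).tl
  | .eq e f => Data.ofBool (decide (e.eval s = f.eval s))

/-- The time to evaluate an expression: the sum of the sizes of the values of all its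
subexpressions, itself included. -/
def Expr.cost (s : Store) : Expr → ℕ
  | .var x => (s x).size
  | .nil => 1
  | .cons e f => e.cost s + f.cost s + ((Expr.cons e f).eval s).size
  | .hd e => e.cost s + ((Expr.hd e).eval s).size
  | .tl e => e.cost s + ((Expr.tl e).eval s).size
  | .eq e f => e.cost s + f.cost s + ((Expr.eq e f).eval s).size

inductive Cmd : Type
  | skip : Cmd
  | assign : ℕ → Expr → Cmd
  | seq : Cmd → Cmd → Cmd
  | ite : Expr → Cmd → Cmd → Cmd
  | loop : Expr → Cmd → Cmd

/-- `Run c s t s'`: started in the store `s`, the program `c` halts after exactly `t` units of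
time in the store `s'`. The command `loop e c` repeats `c` as long as `e` is true. -/
inductive Run : Cmd → Store → ℕ → Store → Prop
  | skip (s : Store) : Run .skip s 1 s
  | assign (x : ℕ) (e : Expr) (s : Store) :
      Run (.assign x e) s (e.cost s + 1) (Function.update s x (e.eval s))
  | seq {c d : Cmd} {s s' s'' : Store} {t t' : ℕ} :
      Run c s t s' → Run d s' t' s'' → Run (.seq c d) s (t + t') s''
  | iteTrue {e : Expr} {c d : Cmd} {s s' : Store} {t : ℕ} :
      e.eval s ≠ .nil → Run c s t s' → Run (.ite e c d) s (e.cost s + 1 + t) s'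
  | iteFalse {e : Expr} {c d : Cmd} {s s' : Store} {t : ℕ} :
      e.eval s = .nil → Run d s t s' → Run (.ite e c d) s (e.cost s + 1 + t) s'
  | loopDone {e : Expr} {c : Cmd} {s : Store} :
      e.eval s = .nil → Run (.loop e c) s (e.cost s + 1) s
  | loopStep {e : Expr} {c : Cmd} {s s' s'' : Store} {t t' : ℕ} :
      e.eval s ≠ .nil → Run c s t s' → Run (.loop e c) s' t' s'' →
        Run (.loop e c) s (e.cost s + 1 + t + t') s''

/-- The initial store: the input is in variable `0`, all other variables hold `nil`. -/
def Store.init (d : Data) : Store := Function.update (fun _ => Data.nil) 0 d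

/-- Started on the input `d`, the program `c` halts after exactly `t` units of time with the
output `o` in variable `0`. -/
def Outputs (c : Cmd) (d : Data) (t : ℕ) (o : Data) : Prop :=
  ∃ s : Store, Run c (Store.init d) t s ∧ s 0 = o

/-- Programs are deterministic: running time and final store are determined by the start. -/
theorem Run.det {c : Cmd} {s s₁ s₂ : Store} {t₁ t₂ : ℕ}
    (h₁ : Run c s t₁ s₁) (h₂ : Run c s t₂ s₂) : t₁ = t₂ ∧ s₁ = s₂ := by
  induction h₁ generalizing t₂ s₂ with
  | skip s => cases h₂; exact ⟨rfl, rfl⟩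
  | assign x e s => cases h₂; exact ⟨rfl, rfl⟩
  | seq _ _ ih ih' =>
    cases h₂ with
    | seq a b =>
      obtain ⟨rfl, rfl⟩ := ih a
      obtain ⟨rfl, rfl⟩ := ih' b
      exact ⟨rfl, rfl⟩
  | iteTrue h _ ih =>
    cases h₂ with
    | iteTrue _ a => obtain ⟨rfl, rfl⟩ := ih a; exact ⟨rfl, rfl⟩
    | iteFalse h' _ => exact absurd h' h
  | iteFalse h _ ih =>
    cases h₂ with
    | iteTrue h' _ => exact absurd h h'
    | iteFalse _ a => obtain ⟨rfl, rfl⟩ := ih a; exact ⟨rfl, rfl⟩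
  | loopDone h =>
    cases h₂ with
    | loopDone _ => exact ⟨rfl, rfl⟩
    | loopStep h' _ _ => exact absurd h h'
  | loopStep h _ _ ih ih' =>
    cases h₂ with
    | loopDone h' => exact absurd h' h
    | loopStep _ a b =>
      obtain ⟨rfl, rfl⟩ := ih a
      obtain ⟨rfl, rfl⟩ := ih' b
      exact ⟨rfl, rfl⟩

/-- A list of trees as a tree. -/
def Data.ofList : List Data → Data
  | [] => .nil
  | a :: l => .cons a (Data.ofList l)

/-- A natural number in unary. -/
def Data.ofNat : ℕ → Data
  | 0 => .nil
  | n + 1 => .cons .nil (Data.ofNat n)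

end TreeWhile

/-! ### The subgroup distance problem in the free group of rank `r` -/

namespace SubgroupDistance

open TreeWhile

/-- Group words in the free generators and their inverses, not necessarily reduced; `(i, true)` is
the generator `i` and `(i, false)` its inverse, so that a word `w` represents `FreeGroup.mk w`. -/
abbrev Word (r : ℕ) : Type := List (Fin r × Bool)

/-- The subgroup generated by the elements that the given words represent. -/
def subgroupOf {r : ℕ} (L : List (Word r)) : Subgroup (FreeGroup (Fin r)) :=
  Subgroup.closure {g | ∃ w ∈ L, FreeGroup.mk w = g}

/-- The word length with respect to the free generators: the least length of a word that
represents `g`. -/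
noncomputable def wordLength {r : ℕ} (g : FreeGroup (Fin r)) : ℕ :=
  sInf {n | ∃ w : Word r, FreeGroup.mk w = g ∧ w.length = n}

/-- The word length is Mathlib's norm, the length of the reduced word. -/
theorem wordLength_eq_norm {r : ℕ} (g : FreeGroup (Fin r)) : wordLength g = g.norm := by
  apply le_antisymm
  · exact Nat.sInf_le ⟨g.toWord, FreeGroup.mk_toWord, rfl⟩
  · obtain ⟨w, rfl, hl⟩ := Nat.sInf_mem (s := {n | ∃ w : Word r, FreeGroup.mk w = g ∧ w.length = n})
      ⟨_, g.toWord, FreeGroup.mk_toWord, rfl⟩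
    exact FreeGroup.norm_mk_le.trans hl.le

/-- The word metric. -/
noncomputable def wordDist {r : ℕ} (g h : FreeGroup (Fin r)) : ℕ := wordLength (g⁻¹ * h)

/-- The correct answers for the subgroups `H` and `K`: two words representing elements of `H` and
`K`, not both trivial, at the least distance among all such pairs; or `none`, if no pair of
elements of `H` and `K` that are not both trivial exists. -/
def IsAnswer {r : ℕ} (H K : Subgroup (FreeGroup (Fin r))) : Option (Word r × Word r) → Prop
  | some (u, v) =>
      FreeGroup.mk u ∈ H ∧ FreeGroup.mk v ∈ K ∧ ¬ (FreeGroup.mk u = 1 ∧ FreeGroup.mk v = 1) ∧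
        ∀ h ∈ H, ∀ k ∈ K, ¬ (h = 1 ∧ k = 1) →
          wordDist (FreeGroup.mk u) (FreeGroup.mk v) ≤ wordDist h k
  | none => ∀ h ∈ H, ∀ k ∈ K, h = 1 ∧ k = 1

def encodeLetter {r : ℕ} (a : Fin r × Bool) : Data :=
  .cons (Data.ofNat a.1) (Data.ofBool a.2)

def encodeWord {r : ℕ} (w : Word r) : Data := Data.ofList (w.map encodeLetter)

def encodeWords {r : ℕ} (L : List (Word r)) : Data := Data.ofList (L.map encodeWord)

def encodeInput {r : ℕ} (L M : List (Word r)) : Data := .cons (encodeWords L) (encodeWords M)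

def encodeAnswer {r : ℕ} : Option (Word r × Word r) → Data
  | none => .nil
  | some (u, v) => .cons (encodeWord u) (encodeWord v)

/-- The size of an input: the number of its words plus their total length. -/
def inputSize {r : ℕ} (L M : List (Word r)) : ℕ :=
  ((L ++ M).map fun w => w.length + 1).sum

end SubgroupDistance

/-!
Stallings folding turns the generators of `H` and of `K` into two finite graphs with labelled edges
in which a reduced word is read along a loop at the base vertex exactly when it represents an
element of the subgroup. Write the reduced words of `h ∈ H` and `k ∈ K` as `z⁻¹ v` and `z⁻¹ w`,
where `v` and `w` do not begin with the same letter; then `d(h, k) = |v| + |w|`. Group elements act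
from the left, so `z` labels a walk from the pair of base vertices to some pair `(p, p')` in the
fibre product of the two graphs, and `v`, `w` label walks from the base vertices to `p` and `p'`.
Replacing `z`, `v` and `w` by shortest reduced words with the same ends and the same first letters
never increases `|v| + |w|`, and it preserves that `v` and `w` diverge and that not all three words
are empty. The new pair is then not trivial either, as `z⁻¹ v = z⁻¹ w = 1` forces `v = z = w`.
There are only polynomially many triples of such shortest words, and comparing them all yields a
closest pair.
-/

/-! ### Trees and encodings -/

namespace TreeWhile

theorem Data.one_le_size (d : Data) : 1 ≤ d.size := by
  cases d <;> simp only [Data.size, le_refl, le_add_iff_nonneg_left, zero_le]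

theorem Data.size_hd_le (d : Data) : d.hd.size ≤ d.size := by
  cases d <;> simp only [Data.hd, Data.size] <;> omega

theorem Data.size_tl_le (d : Data) : d.tl.size ≤ d.size := by
  cases d <;> simp only [Data.tl, Data.size] <;> omega

theorem Data.size_ofBool_le (b : Bool) : (Data.ofBool b).size ≤ 3 := by
  cases b <;> simp only [Data.ofBool, Data.size] <;> omega

theorem Data.ofBool_injective : Function.Injective Data.ofBool := by
  decide

theorem Data.size_ofNat (n : ℕ) : (Data.ofNat n).size = 2 * n + 1 := by
  induction n with
  | zero => rfl
  | succ n ih => simp only [Data.ofNat, Data.size, ih]; ring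

theorem Data.ofNat_injective : Function.Injective Data.ofNat := fun m n h => by
  simpa only [Data.size_ofNat, Nat.add_right_cancel_iff, Nat.mul_left_cancel_iff two_pos] using
    congrArg Data.size h

theorem Data.ofList_injective : Function.Injective Data.ofList := by
  intro l m h
  induction l generalizing m with
  | nil => cases m with
    | nil => rfl
    | cons b m => cases h
  | cons a l ih => cases m with
    | nil => cases h
    | cons b m => rw [(Data.cons.inj h).1, ih (Data.cons.inj h).2]

theorem Expr.size_eval_le_cost (s : Store) (e : Expr) : (e.eval s).size ≤ e.cost s := by
  cases e <;> simp only [Expr.eval, Expr.cost, Data.size, le_refl, le_add_iff_nonneg_left, zero_le]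

/-- Types whose elements are encoded injectively as trees, so that programs can act on them. -/
class TreeEncodable (α : Type*) where
  encode : α → Data
  encode_injective : Function.Injective encode

open TreeEncodable (encode encode_injective)

/-- The size of the tree that encodes `a`. -/
def treeSize {α : Type*} [TreeEncodable α] (a : α) : ℕ := (encode a).size

section Instances

variable {α β : Type*} [TreeEncodable α] [TreeEncodable β]

instance : TreeEncodable Data := ⟨id, Function.injective_id⟩

instance : TreeEncodable Bool := ⟨Data.ofBool, Data.ofBool_injective⟩

instance : TreeEncodable ℕ := ⟨Data.ofNat, Data.ofNat_injective⟩

instance (r : ℕ) : TreeEncodable (Fin r) :=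
  ⟨fun i => Data.ofNat i, Data.ofNat_injective.comp Fin.val_injective⟩

instance : TreeEncodable (α × β) :=
  ⟨fun x => .cons (encode x.1) (encode x.2), fun _ _ h =>
    Prod.ext (encode_injective (Data.cons.inj h).1) (encode_injective (Data.cons.inj h).2)⟩

instance : TreeEncodable (List α) :=
  ⟨fun l => Data.ofList (l.map encode),
    Data.ofList_injective.comp (List.map_injective_iff.2 encode_injective)⟩

instance : TreeEncodable (Option α) :=
  ⟨fun o => encode o.toList, encode_injective.comp fun _ _ h =>
    Option.ext fun a => by rw [← Option.mem_toList, h, Option.mem_toList]⟩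

end Instances

section TreeSize

variable {α β : Type*} [TreeEncodable α] [TreeEncodable β]

theorem size_encode (a : α) : (encode a).size = treeSize a := rfl

theorem treeSize_nat (n : ℕ) : treeSize n = 2 * n + 1 := Data.size_ofNat n

theorem one_le_treeSize (a : α) : 1 ≤ treeSize a := Data.one_le_size _

@[simp] theorem treeSize_mk (a : α) (b : β) : treeSize (a, b) = treeSize a + treeSize b + 1 := rfl

@[simp] theorem treeSize_nil : treeSize ([] : List α) = 1 := rfl

@[simp] theorem treeSize_some (a : α) : treeSize (some a) = treeSize a + 2 := rfl

@[simp] theorem treeSize_cons (a : α) (l : List α) :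
    treeSize (a :: l) = treeSize a + treeSize l + 1 := rfl

theorem treeSize_fst_le (x : α × β) : treeSize x.1 ≤ treeSize x :=
  (Nat.le_add_right _ _).trans (Nat.le_succ _)

theorem treeSize_snd_le (x : α × β) : treeSize x.2 ≤ treeSize x :=
  (Nat.le_add_left _ _).trans (Nat.le_succ _)

theorem treeSize_append (l m : List α) : treeSize (l ++ m) + 1 = treeSize l + treeSize m := by
  induction l with
  | nil => exact add_comm _ _
  | cons a l ih => simp only [List.cons_append, treeSize_cons]; omega

theorem treeSize_reverse (l : List α) : treeSize l.reverse = treeSize l := by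
  induction l with
  | nil => rfl
  | cons a l ih =>
    have := treeSize_append l.reverse [a]
    rw [List.reverse_cons]
    simp only [treeSize_cons, treeSize_nil] at this ⊢
    omega

theorem treeSize_le_of_prefix {l m : List α} (h : l <+: m) : treeSize l ≤ treeSize m := by
  obtain ⟨k, rfl⟩ := h
  have := treeSize_append l k
  have := one_le_treeSize k
  omega

theorem treeSize_le_of_suffix {l m : List α} (h : l <:+ m) : treeSize l ≤ treeSize m := by
  obtain ⟨k, rfl⟩ := h
  have := treeSize_append k l
  have := one_le_treeSize k
  omega

theorem treeSize_le_of_mem {a : α} {l : List α} (h : a ∈ l) : treeSize a ≤ treeSize l := by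
  obtain ⟨k, m, rfl⟩ := List.append_of_mem h
  have := treeSize_le_of_suffix (List.suffix_append k (a :: m))
  rw [treeSize_cons] at this
  omega

theorem length_lt_treeSize (l : List α) : l.length < treeSize l := by
  induction l with
  | nil => exact one_pos
  | cons a l ih => rw [List.length_cons, treeSize_cons]; omega

theorem treeSize_le_of_forall_mem {l : List α} {B : ℕ} (h : ∀ a ∈ l, treeSize a ≤ B) :
    treeSize l ≤ l.length * (B + 1) + 1 := by
  induction l with
  | nil => exact Nat.le_add_left _ _
  | cons a l ih =>
    have ha := h a List.mem_cons_self
    have hl := ih fun b hb => h b (List.mem_cons_of_mem _ hb)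
    rw [treeSize_cons, List.length_cons, add_mul]
    omega

theorem treeSize_flatMap_le {ι : Type*} {l : List ι} {f : ι → List α} {B : ℕ}
    (h : ∀ a ∈ l, treeSize (f a) ≤ B) : treeSize (l.flatMap f) ≤ l.length * B + 1 := by
  induction l with
  | nil => exact Nat.le_add_left _ _
  | cons a l ih =>
    have ha := h a List.mem_cons_self
    have hl := ih fun b hb => h b (List.mem_cons_of_mem _ hb)
    have := treeSize_append (f a) (l.flatMap f)
    rw [List.flatMap_cons, List.length_cons, add_mul]
    omega

end TreeSize

/-! ### Polynomial bounds -/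

/-- The functions to `ℕ` that are bounded by a polynomial in the size of the encoded argument. -/
@[fun_prop]
def PolyBounded {α : Type*} [TreeEncodable α] (f : α → ℕ) : Prop :=
  ∃ p : Polynomial ℕ, ∀ a, f a ≤ p.eval (treeSize a)

theorem polynomial_eval_mono (p : Polynomial ℕ) : Monotone fun n => p.eval n := fun m n h => by
  simp only [Polynomial.eval_eq_sum, Polynomial.sum]
  gcongr

@[fun_prop]
theorem polyBounded_treeSize {α : Type*} [TreeEncodable α] : PolyBounded (treeSize : α → ℕ) :=
  ⟨.X, fun _ => Polynomial.eval_X.ge⟩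

namespace PolyBounded

variable {α β γ : Type*} [TreeEncodable α] [TreeEncodable β] [TreeEncodable γ] {f g : α → ℕ}

theorem mono (hg : PolyBounded g) (h : ∀ a, f a ≤ g a) : PolyBounded f :=
  hg.imp fun _ hp a => (h a).trans (hp a)

@[fun_prop]
theorem const (n : ℕ) : PolyBounded fun _ : α => n :=
  ⟨.C n, fun _ => Polynomial.eval_C.ge⟩

@[fun_prop]
theorem add (hf : PolyBounded f) (hg : PolyBounded g) : PolyBounded fun a => f a + g a := by
  obtain ⟨p, hp⟩ := hf
  obtain ⟨q, hq⟩ := hg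
  exact ⟨p + q, fun a => Polynomial.eval_add (R := ℕ) ▸ add_le_add (hp a) (hq a)⟩

@[fun_prop]
theorem mul (hf : PolyBounded f) (hg : PolyBounded g) : PolyBounded fun a => f a * g a := by
  obtain ⟨p, hp⟩ := hf
  obtain ⟨q, hq⟩ := hg
  exact ⟨p * q, fun a => Polynomial.eval_mul (R := ℕ) ▸ Nat.mul_le_mul (hp a) (hq a)⟩

theorem exists_forall_le {h : β → ℕ} (hh : PolyBounded h) (hg : PolyBounded g) :
    ∃ B : α → ℕ, PolyBounded B ∧ ∀ a b, treeSize b ≤ g a → h b ≤ B a := by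
  obtain ⟨p, hp⟩ := hh
  obtain ⟨q, hq⟩ := hg
  exact ⟨fun a => p.eval (q.eval (treeSize a)), ⟨p.comp q, fun _ => Polynomial.eval_comp.ge⟩,
    fun a b hb => (hp b).trans (polynomial_eval_mono p (hb.trans (hq a)))⟩

theorem comp {h : β → ℕ} {k : α → β} (hh : PolyBounded h)
    (hk : PolyBounded fun a => treeSize (k a)) : PolyBounded fun a => h (k a) := by
  obtain ⟨B, hB, hle⟩ := hh.exists_forall_le hk
  exact hB.mono fun a => hle a (k a) le_rfl

end PolyBounded

/-! ### Running times of programs -/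

/-- Started in the store `s`, the program `c` halts within `n` units of time in a store with the
property `Q`. -/
def HaltsWithin (c : Cmd) (s : Store) (n : ℕ) (Q : Store → Prop) : Prop :=
  ∃ t ≤ n, ∃ s', Run c s t s' ∧ Q s'

namespace HaltsWithin

variable {c d : Cmd} {s : Store} {n m : ℕ} {Q R : Store → Prop}

theorem mono (h : HaltsWithin c s n Q) (hnm : n ≤ m) (hQR : ∀ s', Q s' → R s') :
    HaltsWithin c s m R := by
  obtain ⟨t, ht, s', hrun, hs'⟩ := h
  exact ⟨t, ht.trans hnm, s', hrun, hQR s' hs'⟩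

theorem assign {x : ℕ} {e : Expr} (hn : e.cost s + 1 ≤ n)
    (hQ : Q (Function.update s x (e.eval s))) : HaltsWithin (.assign x e) s n Q :=
  ⟨_, hn, _, .assign x e s, hQ⟩

theorem seq (hc : HaltsWithin c s n Q) (hd : ∀ s', Q s' → HaltsWithin d s' m R) :
    HaltsWithin (.seq c d) s (n + m) R := by
  obtain ⟨t, ht, s', hrun, hs'⟩ := hc
  obtain ⟨t', ht', s'', hrun', hs''⟩ := hd s' hs'
  exact ⟨t + t', add_le_add ht ht', s'', hrun.seq hrun', hs''⟩

theorem loop {e : Expr} {I : ℕ → Store → Prop} {E C : ℕ}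
    (hcost : ∀ k s, I k s → e.cost s ≤ E) (hdone : ∀ s, I 0 s → e.eval s = .nil)
    (hstep : ∀ k s, I (k + 1) s → e.eval s ≠ .nil ∧ HaltsWithin c s C (I k))
    {k : ℕ} (hs : I k s) : HaltsWithin (.loop e c) s ((k + 1) * (E + 1 + C)) (I 0) := by
  induction k generalizing s with
  | zero =>
    have := hcost 0 s hs
    exact ⟨e.cost s + 1, by omega, s, .loopDone (hdone s hs), hs⟩
  | succ k ih =>
    have := hcost (k + 1) s hs
    obtain ⟨htrue, t, ht, s', hrun, hs'⟩ := hstep k s hs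
    obtain ⟨t', ht', s'', hrun', hs''⟩ := ih hs'
    refine ⟨_, ?_, s'', .loopStep htrue hrun hrun', hs''⟩
    rw [add_mul (k + 1), one_mul]
    omega

end HaltsWithin

theorem Run.size_le {c : Cmd} {s s' : Store} {t : ℕ} (h : Run c s t s') (x : ℕ) :
    (s' x).size ≤ (s x).size + t := by
  induction h with
  | skip s => exact Nat.le_add_right _ _
  | assign y e s =>
    have := e.size_eval_le_cost s
    rcases eq_or_ne x y with rfl | hxy
    · rw [Function.update_self]; omega
    · rw [Function.update_of_ne hxy]; omega
  | loopDone _ => exact Nat.le_add_right _ _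
  | _ => omega

/-! ### Functions computable in polynomial time -/

open TreeEncodable (encode encode_injective)

/-- The program `c` computes `f` from variable `i` into variable `j` within the time `T`. It may
use the variables above `j` as scratch space but leaves those below `j` unchanged. -/
def Computes {α β : Type*} [TreeEncodable α] [TreeEncodable β] (c : Cmd) (i j : ℕ) (f : α → β)
    (T : α → ℕ) : Prop :=
  ∀ s a, s i = encode a →
    HaltsWithin c s (T a) fun s' => s' j = encode (f a) ∧ ∀ x < j, s' x = s x

/-- The functions that a program computes in polynomial time, for every choice of the variables
that hold the argument and the result. -/
@[fun_prop]
def PolyTime {α β : Type*} [TreeEncodable α] [TreeEncodable β] (f : α → β) : Prop :=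
  ∀ i j, ∃ c T, PolyBounded T ∧ Computes c i j f T

theorem Data.exists_expr_eval_eq (d : Data) :
    ∃ (e : Expr) (n : ℕ), ∀ s, e.eval s = d ∧ e.cost s = n := by
  induction d with
  | nil => exact ⟨.nil, 1, fun s => ⟨rfl, rfl⟩⟩
  | cons a b iha ihb =>
    obtain ⟨e, n, he⟩ := iha
    obtain ⟨f, m, hf⟩ := ihb
    refine ⟨.cons e f, n + m + (Data.cons a b).size, fun s => ⟨?_, ?_⟩⟩
    · rw [Expr.eval, (he s).1, (hf s).1]
    · rw [Expr.cost, Expr.eval, (he s).1, (hf s).1, (he s).2, (hf s).2]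

namespace PolyTime

variable {α β γ δ : Type*} [TreeEncodable α] [TreeEncodable β] [TreeEncodable γ] [TreeEncodable δ]

@[fun_prop]
theorem polyBounded_treeSize {f : α → β} (hf : PolyTime f) :
    PolyBounded fun a => treeSize (f a) := by
  obtain ⟨c, T, hT, hc⟩ := hf 0 0
  have hle : PolyBounded fun a => treeSize a + T a := by fun_prop
  refine hle.mono fun a => ?_
  obtain ⟨t, ht, s', hrun, hs', -⟩ := hc (fun _ => encode a) a rfl
  calc treeSize (f a) = (s' 0).size := congrArg Data.size hs'.symm
    _ ≤ treeSize a + t := hrun.size_le 0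
    _ ≤ treeSize a + T a := Nat.add_le_add_left ht _

theorem of_expr {f : α → β} {T : α → ℕ} (hT : PolyBounded T) (e : ℕ → Expr)
    (h : ∀ i s a, s i = encode a → (e i).eval s = encode (f a) ∧ (e i).cost s ≤ T a) :
    PolyTime f := fun i j => by
  refine ⟨.assign j (e i), fun a => T a + 1, by fun_prop, fun s a hs => ?_⟩
  obtain ⟨heval, hcost⟩ := h i s a hs
  exact .assign (Nat.succ_le_succ hcost)
    ⟨by rw [Function.update_self, heval], fun x hx => Function.update_of_ne hx.ne _ _⟩

theorem of_encode_eq {f : α → β} (h : ∀ a, encode (f a) = encode a) : PolyTime f :=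
  of_expr TreeWhile.polyBounded_treeSize .var fun i s a hs => by
    simp only [Expr.eval, Expr.cost, hs, h, treeSize, le_refl, and_self]

theorem of_encode_eq_hd {f : α → β} (h : ∀ a, encode (f a) = (encode a).hd) : PolyTime f :=
  of_expr (T := fun a => treeSize a + treeSize a) (by fun_prop)
    (fun i => .hd (.var i)) fun i s a hs => by
      simp only [Expr.eval, Expr.cost, hs, h, true_and]
      exact Nat.add_le_add_left (Data.size_hd_le _) _

theorem of_encode_eq_tl {f : α → β} (h : ∀ a, encode (f a) = (encode a).tl) : PolyTime f :=
  of_expr (T := fun a => treeSize a + treeSize a) (by fun_prop)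
    (fun i => .tl (.var i)) fun i s a hs => by
      simp only [Expr.eval, Expr.cost, hs, h, true_and]
      exact Nat.add_le_add_left (Data.size_tl_le _) _

@[fun_prop]
theorem id : PolyTime fun a : α => a :=
  of_encode_eq fun _ => rfl

@[fun_prop]
theorem const (b : β) : PolyTime fun _ : α => b := by
  obtain ⟨e, n, he⟩ := (encode b).exists_expr_eval_eq
  exact of_expr (.const n) (fun _ => e) fun i s a _ => ⟨(he s).1, (he s).2.le⟩

@[fun_prop]
theorem comp {g : β → γ} {f : α → β} (hg : PolyTime g) (hf : PolyTime f) :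
    PolyTime fun a => g (f a) := fun i j => by
  obtain ⟨c, T, hT, hc⟩ := hf i j
  obtain ⟨d, U, hU, hd⟩ := hg j j
  refine ⟨.seq c d, fun a => T a + U (f a), hT.add (hU.comp hf.polyBounded_treeSize),
    fun s a hs => (hc s a hs).seq fun s' hs' => ?_⟩
  exact (hd s' (f a) hs'.1).mono le_rfl fun s'' hs'' =>
    ⟨hs''.1, fun x hx => (hs''.2 x hx).trans (hs'.2 x hx)⟩

theorem of_expr₂ {f : α → β} {g : α → γ} {k : α → δ} (hf : PolyTime f) (hg : PolyTime g)
    {T : α → ℕ} (hT : PolyBounded T) (e : ℕ → ℕ → Expr)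
    (h : ∀ i j s a, s i = encode (f a) → s j = encode (g a) →
      (e i j).eval s = encode (k a) ∧ (e i j).cost s ≤ T a) : PolyTime k := fun i j => by
  set m := max i j + 1
  have him : i < m := Nat.lt_succ_of_le (le_max_left i j)
  have hjm : j < m := Nat.lt_succ_of_le (le_max_right i j)
  obtain ⟨c, U, hU, hc⟩ := hf i m
  obtain ⟨d, V, hV, hd⟩ := hg i (m + 1)
  refine ⟨.seq c (.seq d (.assign j (e m (m + 1)))), fun a => U a + (V a + (T a + 1)),
    by fun_prop, fun s a hs => (hc s a hs).seq fun s' hs' => ?_⟩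
  refine (hd s' a ((hs'.2 i him).trans hs)).seq fun s'' hs'' => ?_
  obtain ⟨heval, hcost⟩ := h m (m + 1) s'' a ((hs''.2 m m.lt_succ_self).trans hs'.1) hs''.1
  refine .assign (Nat.succ_le_succ hcost) ⟨by rw [Function.update_self, heval], fun x hx => ?_⟩
  rw [Function.update_of_ne hx.ne, hs''.2 x (by omega), hs'.2 x (by omega)]

theorem of_encode_eq_cons {f : α → β} {g : α → γ} {k : α → δ} (hf : PolyTime f) (hg : PolyTime g)
    (h : ∀ a, encode (k a) = .cons (encode (f a)) (encode (g a))) : PolyTime k :=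
  of_expr₂ hf hg (T := fun a => treeSize (f a) + treeSize (g a) +
    (treeSize (f a) + treeSize (g a) + 1)) (by fun_prop) (fun i j => .cons (.var i) (.var j))
    fun i j s a hi hj => by
      simp only [Expr.eval, Expr.cost, hi, hj, h, true_and]
      exact le_rfl

@[fun_prop]
theorem decide_eq [DecidableEq β] {f g : α → β} (hf : PolyTime f) (hg : PolyTime g) :
    PolyTime fun a => decide (f a = g a) :=
  of_expr₂ hf hg (T := fun a => treeSize (f a) + treeSize (g a) + 3) (by fun_prop)
    (fun i j => .eq (.var i) (.var j)) fun i j s a hi hj => by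
      simp only [Expr.eval, Expr.cost, hi, hj, encode_injective.eq_iff]
      exact ⟨rfl, Nat.add_le_add_left (Data.size_ofBool_le _) _⟩

section Foldl

variable {l : α → List γ} {seed : α → β} {g : α → β → γ → β}

/-- The body of the loop that folds a list: variable `i` holds the parameter, `m` the accumulator
and `m + 1` the remaining list, and the program `c` transforms variable `m + 2`. -/
def foldlBody (c : Cmd) (i m : ℕ) : Cmd :=
  .seq (.assign (m + 2) (.cons (.var i) (.cons (.var m) (.hd (.var (m + 1))))))
    (.seq c (.seq (.assign m (.var (m + 2))) (.assign (m + 1) (.tl (.var (m + 1))))))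

theorem haltsWithin_foldlBody {T : α × β × γ → ℕ} {c : Cmd} {i m : ℕ}
    (hc : Computes c (m + 2) (m + 2) (fun x : α × β × γ => g x.1 x.2.1 x.2.2) T)
    {s : Store} {a : α} {b : β} {e : γ} {k : List γ} (hi : s i = encode a) (hm : s m = encode b)
    (hk : s (m + 1) = encode (e :: k)) :
    HaltsWithin (foldlBody c i m) s
      (2 * treeSize a + 3 * treeSize b + 6 * treeSize (e :: k) + T (a, b, e) +
        treeSize (g a b e) + 5)
      fun s' => s' m = encode (g a b e) ∧ s' (m + 1) = encode k ∧ ∀ x < m, s' x = s x := by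
  have hhd : (encode (e :: k)).hd = encode e := rfl
  have htl : (encode (e :: k)).tl = encode k := rfl
  have load : HaltsWithin (.assign (m + 2) (.cons (.var i) (.cons (.var m) (.hd (.var (m + 1))))))
      s (2 * treeSize a + 3 * treeSize b + 4 * treeSize (e :: k) + 4) fun s' =>
        s' (m + 2) = encode (a, b, e) ∧ ∀ x < m + 2, s' x = s x := by
    refine .assign ?_ ⟨?_, fun x hx => Function.update_of_ne hx.ne _ _⟩
    · simp only [Expr.cost, Expr.eval, hi, hm, hk, hhd, Data.size, size_encode, treeSize_cons]
      omega
    · simp only [Function.update_self, Expr.eval, hi, hm, hk, hhd]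
      rfl
  have store (s : Store) (hs : s (m + 2) = encode (g a b e)) :
      HaltsWithin (.assign m (.var (m + 2))) s (treeSize (g a b e) + 1) fun s' =>
        s' m = encode (g a b e) ∧ ∀ x ≠ m, s' x = s x :=
    .assign (by rw [Expr.cost, hs, size_encode])
      ⟨by rw [Function.update_self, Expr.eval, hs], fun x hx => Function.update_of_ne hx _ _⟩
  have advance (s : Store) (hs : s (m + 1) = encode (e :: k)) :
      HaltsWithin (.assign (m + 1) (.tl (.var (m + 1)))) s (2 * treeSize (e :: k)) fun s' =>
        s' (m + 1) = encode k ∧ ∀ x < m + 1, s' x = s x := by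
    refine .assign ?_ ⟨?_, fun x hx => Function.update_of_ne hx.ne _ _⟩
    · simp only [Expr.cost, Expr.eval, hs, htl, size_encode, treeSize_cons]
      have := one_le_treeSize e
      omega
    · rw [Function.update_self, Expr.eval, Expr.eval, hs, htl]
  refine (load.seq fun s₁ h₁ => (hc s₁ _ h₁.1).seq fun s₂ h₂ => (store s₂ h₂.1).seq fun s₃ h₃ =>
    (advance s₃ ?_).mono le_rfl fun s₄ h₄ => ?_).mono (by omega) fun _ => _root_.id
  · rw [h₃.2 _ m.succ_ne_self, h₂.2 _ (by omega), h₁.2 _ (by omega), hk]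
  · exact ⟨(h₄.2 m m.lt_succ_self).trans h₃.1, h₄.1, fun x hx => by
      rw [h₄.2 x (by omega), h₃.2 x hx.ne, h₂.2 x (by omega), h₁.2 x (by omega)]⟩

theorem haltsWithin_foldl_loop {T : α × β × γ → ℕ} {c : Cmd} {i m : ℕ} (him : i < m)
    (hc : Computes c (m + 2) (m + 2) (fun x : α × β × γ => g x.1 x.2.1 x.2.2) T)
    {s : Store} {a : α} {b : β} {k : List γ} (hi : s i = encode a) (hm : s m = encode b)
    (hk : s (m + 1) = encode k) {B D : ℕ} (hB : ∀ p, p <+: k → treeSize (p.foldl (g a) b) ≤ B)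
    (hD : ∀ b', treeSize b' ≤ B → ∀ e ∈ k, T (a, b', e) ≤ D) :
    HaltsWithin (.loop (.var (m + 1)) (foldlBody c i m)) s
      ((treeSize k + 1) * (treeSize k + 1 + (2 * treeSize a + 4 * B + 6 * treeSize k + D + 5)))
      fun s' => s' m = encode (k.foldl (g a) b) ∧ ∀ x < m, s' x = s x := by
  let I (n : ℕ) (s' : Store) : Prop := ∃ p q, p ++ q = k ∧ q.length = n ∧
    s' m = encode (p.foldl (g a) b) ∧ s' (m + 1) = encode q ∧ ∀ x < m, s' x = s x
  have start : I k.length s := ⟨[], k, rfl, rfl, hm, hk, fun _ _ => rfl⟩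
  refine (HaltsWithin.loop (I := I) ?_ ?_ ?_ start).mono
    (Nat.mul_le_mul_right _ (Nat.succ_le_succ (length_lt_treeSize k).le)) ?_
  · rintro n s' ⟨p, q, rfl, -, -, hq, -⟩
    rw [Expr.cost, hq]
    exact treeSize_le_of_suffix (List.suffix_append p q)
  · rintro s' ⟨p, q, -, hn, -, hq, -⟩
    rw [Expr.eval, hq, List.length_eq_zero_iff.1 hn]
    rfl
  · rintro n s' ⟨p, _ | ⟨e, q⟩, hpq, hn, hp, hq, hx⟩
    · cases hn
    have hsplit : (p ++ [e]) ++ q = k := by rw [List.append_assoc, List.singleton_append, hpq]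
    have hfold : (p ++ [e]).foldl (g a) b = g a (p.foldl (g a) b) e := by
      rw [List.foldl_append, List.foldl_cons, List.foldl_nil]
    refine ⟨by rw [Expr.eval, hq]; exact Data.noConfusion, ?_⟩
    refine (haltsWithin_foldlBody hc ((hx i him).trans hi) hp hq).mono ?_ fun s'' h =>
      ⟨p ++ [e], q, hsplit, Nat.succ.inj hn, hfold ▸ h.1, h.2.1,
        fun x hxm => (h.2.2 x hxm).trans (hx x hxm)⟩
    have hacc := hB p ⟨_, hpq⟩
    have hnext := hB (p ++ [e]) ⟨q, hsplit⟩
    have hrest := treeSize_le_of_suffix ⟨p, hpq⟩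
    have htime := hD _ hacc e (hpq ▸ List.mem_append_right p List.mem_cons_self)
    rw [hfold] at hnext
    omega
  · rintro s' ⟨p, q, hpq, hn, hp, -, hx⟩
    rw [List.length_eq_zero_iff.1 hn, List.append_nil] at hpq
    exact ⟨hpq ▸ hp, hx⟩

theorem list_foldl (hl : PolyTime l) (hseed : PolyTime seed)
    (hg : PolyTime fun x : α × β × γ => g x.1 x.2.1 x.2.2) {B : α → ℕ} (hB : PolyBounded B)
    (hle : ∀ a p, p <+: l a → treeSize (p.foldl (g a) (seed a)) ≤ B a) :
    PolyTime fun a => (l a).foldl (g a) (seed a) := fun i j => by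
  set m := max i j + 1
  have him : i < m := Nat.lt_succ_of_le (le_max_left i j)
  have hjm : j < m := Nat.lt_succ_of_le (le_max_right i j)
  obtain ⟨c, U, hU, hc⟩ := hseed i m
  obtain ⟨d, V, hV, hd⟩ := hl i (m + 1)
  obtain ⟨e, T, hT, he⟩ := hg (m + 2) (m + 2)
  have := hl.polyBounded_treeSize
  obtain ⟨D, hD, hTD⟩ := hT.exists_forall_le
    (g := fun a => treeSize a + (B a + treeSize (l a) + 2)) (by fun_prop)
  let W (a : α) : ℕ := (treeSize (l a) + 1) *
    (treeSize (l a) + 1 + (2 * treeSize a + 4 * B a + 6 * treeSize (l a) + D a + 5))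
  have hW : PolyBounded W := by fun_prop
  refine ⟨.seq c (.seq d (.seq (.loop (.var (m + 1)) (foldlBody e i m)) (.assign j (.var m)))),
    fun a => U a + (V a + (W a + (B a + 1))),
    by fun_prop, fun s a hs => ?_⟩
  refine (hc s a hs).seq fun s₁ h₁ => (hd s₁ a ((h₁.2 i him).trans hs)).seq fun s₂ h₂ => ?_
  have hi : s₂ i = encode a := by rw [h₂.2 i (by omega), h₁.2 i him, hs]
  have hm : s₂ m = encode (seed a) := (h₂.2 m m.lt_succ_self).trans h₁.1
  refine (haltsWithin_foldl_loop him he hi hm h₂.1 (hle a) fun b hb e' he' => ?_).seq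
    fun s₃ h₃ => .assign ?_ ⟨by rw [Function.update_self, Expr.eval, h₃.1], fun x hx => ?_⟩
  · have := treeSize_le_of_mem he'
    exact hTD a _ (by simp only [treeSize_mk]; omega)
  · rw [Expr.cost, h₃.1]
    exact Nat.succ_le_succ (hle a _ List.prefix_rfl)
  · rw [Function.update_of_ne hx.ne, h₃.2 x (by omega), h₂.2 x (by omega), h₁.2 x (by omega)]

end Foldl

theorem of_eq {f g : α → β} (hf : PolyTime f) (h : ∀ a, f a = g a) : PolyTime g :=
  funext h ▸ hf

@[fun_prop]
theorem fst {f : α → β × γ} (hf : PolyTime f) : PolyTime fun a => (f a).1 :=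
  comp (g := Prod.fst) (of_encode_eq_hd fun _ => rfl) hf

@[fun_prop]
theorem snd {f : α → β × γ} (hf : PolyTime f) : PolyTime fun a => (f a).2 :=
  comp (g := Prod.snd) (of_encode_eq_tl fun _ => rfl) hf

@[fun_prop]
theorem pair {f : α → β} {g : α → γ} (hf : PolyTime f) (hg : PolyTime g) :
    PolyTime fun a => (f a, g a) :=
  of_encode_eq_cons hf hg fun _ => rfl

@[fun_prop]
theorem list_cons {f : α → β} {l : α → List β} (hf : PolyTime f) (hl : PolyTime l) :
    PolyTime fun a => f a :: l a :=
  of_encode_eq_cons hf hl fun _ => rfl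

@[fun_prop]
theorem option_some {f : α → β} (hf : PolyTime f) : PolyTime fun a => some (f a) :=
  of_encode_eq_cons hf (const ([] : List β)) fun _ => rfl

@[fun_prop]
theorem option_toList {o : α → Option β} (ho : PolyTime o) : PolyTime fun a => (o a).toList :=
  comp (g := Option.toList) (of_encode_eq fun _ => rfl) ho

@[fun_prop]
theorem list_reverse {l : α → List β} (hl : PolyTime l) : PolyTime fun a => (l a).reverse := by
  have hfold : PolyTime fun a => (l a).foldl (fun m b => b :: m) [] :=
    list_foldl hl (const []) (by fun_prop) hl.polyBounded_treeSize fun a p hp => by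
      rw [List.foldl_flip_cons_eq_append', List.append_nil, treeSize_reverse]
      exact treeSize_le_of_prefix hp
  simpa only [List.foldl_flip_cons_eq_append', List.append_nil] using hfold

theorem list_foldr {l : α → List γ} {seed : α → β} {g : α → γ → β → β} (hl : PolyTime l)
    (hseed : PolyTime seed) (hg : PolyTime fun x : α × γ × β => g x.1 x.2.1 x.2.2) {B : α → ℕ}
    (hB : PolyBounded B) (hle : ∀ a q, q <:+ l a → treeSize (q.foldr (g a) (seed a)) ≤ B a) :
    PolyTime fun a => (l a).foldr (g a) (seed a) := by
  have hswap : PolyTime fun x : α × β × γ => g x.1 x.2.2 x.2.1 :=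
    hg.comp (f := fun x : α × β × γ => (x.1, x.2.2, x.2.1)) (by fun_prop)
  have hfold : PolyTime fun a => (l a).reverse.foldl (fun b c => g a c b) (seed a) :=
    list_foldl hl.list_reverse hseed hswap hB fun a p hp => by
      rw [← List.foldr_reverse]
      exact hle a _ (List.reverse_prefix.1 (by rwa [List.reverse_reverse]))
  simpa only [List.foldl_reverse] using hfold

@[fun_prop]
theorem list_append {l m : α → List β} (hl : PolyTime l) (hm : PolyTime m) :
    PolyTime fun a => l a ++ m a := by
  have hfold : PolyTime fun a => (l a).foldr List.cons (m a) :=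
    list_foldr (g := fun _ => List.cons) hl hm (by fun_prop)
      (B := fun a => treeSize (l a) + treeSize (m a)) (by fun_prop) fun a q hq => by
        have := treeSize_append q (m a)
        have := treeSize_le_of_suffix hq
        rw [List.foldr_cons_eq_append']
        omega
  simpa only [List.foldr_cons_eq_append'] using hfold

@[fun_prop]
theorem list_flatMap {l : α → List β} {f : α → β → List γ} (hl : PolyTime l)
    (hf : PolyTime fun x : α × β => f x.1 x.2) : PolyTime fun a => (l a).flatMap (f a) := by
  obtain ⟨B, hB, hle⟩ := hf.polyBounded_treeSize.exists_forall_le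
    (g := fun a => treeSize a + treeSize (l a) + 1) (by fun_prop)
  have hfold (a : α) (q : List β) :
      q.foldr (fun b m => f a b ++ m) [] = q.flatMap (f a) := by
    rw [List.foldr_append_eq_append, List.append_nil, List.flatMap_def]
  have := list_foldr (g := fun a b m => f a b ++ m) hl (const [])
    ((hf.comp (f := fun x : α × β × List γ => (x.1, x.2.1)) (by fun_prop)).list_append
      (by fun_prop))
    (B := fun a => treeSize (l a) * B a + 1) (by fun_prop) fun a q hq => by
      have hfB : ∀ b ∈ q, treeSize (f a b) ≤ B a := fun b hb =>
        hle a (a, b) (by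
          have := treeSize_le_of_mem (hq.subset hb)
          rw [treeSize_mk]
          omega)
      have hlen : q.length ≤ treeSize (l a) := hq.length_le.trans (length_lt_treeSize _).le
      rw [hfold]
      exact (treeSize_flatMap_le hfB).trans (by gcongr)
  simpa only [hfold] using this

@[fun_prop]
theorem list_map {l : α → List β} {f : α → β → γ} (hl : PolyTime l)
    (hf : PolyTime fun x : α × β => f x.1 x.2) : PolyTime fun a => (l a).map (f a) := by
  simp only [List.map_eq_flatMap]
  fun_prop

@[fun_prop]
theorem list_filterMap {l : α → List β} {f : α → β → Option γ} (hl : PolyTime l)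
    (hf : PolyTime fun x : α × β => f x.1 x.2) : PolyTime fun a => (l a).filterMap (f a) := by
  simp only [List.filterMap_eq_flatMap_toList]
  fun_prop

@[fun_prop]
theorem list_product {l : α → List β} {m : α → List γ} (hl : PolyTime l) (hm : PolyTime m) :
    PolyTime fun a => l a ×ˢ m a :=
  list_flatMap (f := fun a b => (m a).map (Prod.mk b)) hl (by fun_prop)

@[fun_prop]
theorem option_elim {o : α → Option β} {d : α → γ} {f : α → β → γ} (ho : PolyTime o)
    (hd : PolyTime d) (hf : PolyTime fun x : α × β => f x.1 x.2) :
    PolyTime fun a => (o a).elim (d a) (f a) := by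
  obtain ⟨B, hB, hle⟩ := hf.polyBounded_treeSize.exists_forall_le
    (g := fun a => treeSize a + treeSize (o a) + 1) (by fun_prop)
  have hfold : PolyTime fun a => (o a).toList.foldr (fun b _ => f a b) (d a) :=
    list_foldr (g := fun a b _ => f a b) (by fun_prop) hd
      (hf.comp (f := fun x : α × β × γ => (x.1, x.2.1)) (by fun_prop))
      (B := fun a => treeSize (d a) + B a) (by fun_prop) fun a q hq => by
        rcases hoa : o a with _ | b
        · rw [hoa, Option.toList_none, List.suffix_nil] at hq
          exact hq ▸ Nat.le_add_right _ _
        have hb : treeSize (f a b) ≤ B a :=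
          hle a (a, b) (by rw [hoa, treeSize_mk, treeSize_some]; omega)
        rw [hoa, Option.toList_some, List.suffix_cons_iff, List.suffix_nil] at hq
        rcases hq with rfl | rfl
        · exact hb.trans (Nat.le_add_left _ _)
        · exact Nat.le_add_right _ _
  exact hfold.of_eq fun a => by cases o a <;> rfl

@[fun_prop]
theorem option_map {o : α → Option β} {f : α → β → γ} (ho : PolyTime o)
    (hf : PolyTime fun x : α × β => f x.1 x.2) : PolyTime fun a => (o a).map (f a) := by
  have helim : PolyTime fun a => (o a).elim none fun b => some (f a b) := by fun_prop
  exact helim.of_eq fun a => by cases o a <;> rfl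

@[fun_prop]
theorem cond {b : α → Bool} {f g : α → β} (hb : PolyTime b) (hf : PolyTime f)
    (hg : PolyTime g) : PolyTime fun a => bif b a then f a else g a := by
  have hoption : PolyTime fun c : Bool => bif c then some Data.nil else none :=
    of_encode_eq fun c => by cases c <;> rfl
  have helim : PolyTime fun a =>
      (bif b a then some Data.nil else none).elim (g a) fun _ => f a :=
    (hoption.comp hb).option_elim hg (by fun_prop)
  exact helim.of_eq fun a => by cases b a <;> rfl

@[fun_prop]
theorem ite {p : α → Prop} [DecidablePred p] {f g : α → β} (hp : PolyTime fun a => decide (p a))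
    (hf : PolyTime f) (hg : PolyTime g) : PolyTime fun a => if p a then f a else g a := by
  simp only [← Bool.cond_decide]
  fun_prop

@[fun_prop]
theorem decide_not {p : α → Prop} [DecidablePred p] (hp : PolyTime fun a => decide (p a)) :
    PolyTime fun a => decide (¬ p a) := by
  have hite : PolyTime fun a => if p a then false else true := by fun_prop
  exact hite.of_eq fun a => by by_cases h : p a <;> simp [h]

@[fun_prop]
theorem decide_and {p q : α → Prop} [DecidablePred p] [DecidablePred q]
    (hp : PolyTime fun a => decide (p a)) (hq : PolyTime fun a => decide (q a)) :
    PolyTime fun a => decide (p a ∧ q a) := by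
  have hite : PolyTime fun a => if p a then decide (q a) else false := by fun_prop
  exact hite.of_eq fun a => by by_cases h : p a <;> simp [h]

@[fun_prop]
theorem decide_or {p q : α → Prop} [DecidablePred p] [DecidablePred q]
    (hp : PolyTime fun a => decide (p a)) (hq : PolyTime fun a => decide (q a)) :
    PolyTime fun a => decide (p a ∨ q a) := by
  have hite : PolyTime fun a => if p a then true else decide (q a) := by fun_prop
  exact hite.of_eq fun a => by by_cases h : p a <;> simp [h]

@[fun_prop]
theorem list_filter {l : α → List β} {p : α → β → Bool} (hl : PolyTime l)
    (hp : PolyTime fun x : α × β => p x.1 x.2) : PolyTime fun a => (l a).filter (p a) := by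
  have hmap : PolyTime fun a => (l a).flatMap fun b => bif p a b then [b] else [] := by fun_prop
  exact hmap.of_eq fun a => by
    induction l a with
    | nil => rfl
    | cons b l ih => cases h : p a b <;> simp [h, ih]

@[fun_prop]
theorem list_head? {l : α → List β} (hl : PolyTime l) : PolyTime fun a => (l a).head? := by
  have hhead (l : List β) : l.foldr (fun b _ => some b) none = l.head? := by cases l <;> rfl
  have hfold : PolyTime fun a => (l a).foldr (fun b _ => some b) none :=
    list_foldr (g := fun _ b _ => some b) hl (const none) (by fun_prop)
      (B := fun a => treeSize (l a) + 2) (by fun_prop) fun a q hq => by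
        have := treeSize_le_of_suffix hq
        cases q with
        | nil => exact Nat.le_add_left 1 _
        | cons b q => simp only [List.foldr_cons, treeSize_some, treeSize_cons] at this ⊢; omega
  exact hfold.of_eq fun a => hhead (l a)

@[fun_prop]
theorem list_find? {l : α → List β} {p : α → β → Bool} (hl : PolyTime l)
    (hp : PolyTime fun x : α × β => p x.1 x.2) : PolyTime fun a => (l a).find? (p a) := by
  simp only [← List.head?_filter]
  fun_prop

theorem nat_iterate {n : α → ℕ} {f : α → β → β} {b : α → β} (hn : PolyTime n)
    (hf : PolyTime fun x : α × β => f x.1 x.2) (hb : PolyTime b) {B : α → ℕ}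
    (hB : PolyBounded B) (hle : ∀ a, ∀ k ≤ n a, treeSize ((f a)^[k] (b a)) ≤ B a) :
    PolyTime fun a => (f a)^[n a] (b a) := by
  have hreplicate : PolyTime fun k : ℕ => List.replicate k Data.nil := of_encode_eq fun k => by
    induction k with
    | zero => rfl
    | succ k ih => exact congrArg (Data.cons .nil) ih
  have hfold : PolyTime fun a => (List.replicate (n a) Data.nil).foldl (fun b _ => f a b) (b a) :=
    list_foldl (g := fun a b _ => f a b) (hreplicate.comp hn) hb
      (hf.comp (f := fun x : α × β × Data => (x.1, x.2.1)) (by fun_prop)) hB fun a p hp => by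
        rw [List.foldl_const]
        exact hle a _ (hp.length_le.trans List.length_replicate.le)
  simpa only [List.foldl_const, List.length_replicate] using hfold

@[fun_prop]
theorem nat_succ {n : α → ℕ} (hn : PolyTime n) : PolyTime fun a => n a + 1 :=
  of_encode_eq_cons (const Data.nil) hn fun _ => rfl

@[fun_prop]
theorem nat_sub {m n : α → ℕ} (hm : PolyTime m) (hn : PolyTime n) :
    PolyTime fun a => m a - n a := by
  have hpred : PolyTime Nat.pred := of_encode_eq_tl fun k => by cases k <;> rfl
  simp only [← Nat.pred_iterate]
  refine nat_iterate hn (hpred.comp (by fun_prop)) hm (hm.polyBounded_treeSize) fun a k _ => ?_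
  simp only [Nat.pred_iterate, treeSize_nat]
  omega

@[fun_prop]
theorem decide_lt {m n : α → ℕ} (hm : PolyTime m) (hn : PolyTime n) :
    PolyTime fun a => decide (m a < n a) := by
  have hsub : PolyTime fun a => decide (¬ n a - m a = 0) := by fun_prop
  exact hsub.of_eq fun a => decide_eq_decide.2 (by omega)

@[fun_prop]
theorem list_length {l : α → List β} (hl : PolyTime l) : PolyTime fun a => (l a).length := by
  have hlength (l : List β) : l.foldr (fun _ n => n + 1) 0 = l.length := by
    induction l with
    | nil => rfl
    | cons b l ih => rw [List.foldr_cons, ih, List.length_cons]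
  have hfold : PolyTime fun a => (l a).foldr (fun _ n => n + 1) 0 :=
    list_foldr (g := fun _ _ n => n + 1) hl (const 0) (by fun_prop)
      (B := fun a => 2 * treeSize (l a) + 1) (by fun_prop) fun a q hq => by
        have := length_lt_treeSize q
        have := treeSize_le_of_suffix hq
        rw [hlength, treeSize_nat]
        omega
  exact hfold.of_eq fun a => hlength (l a)

@[fun_prop]
theorem list_argmin {l : α → List β} {f : α → β → ℕ} (hl : PolyTime l)
    (hf : PolyTime fun x : α × β => f x.1 x.2) : PolyTime fun a => (l a).argmin (f a) := by
  let step (a : α) (o : Option β) (b : β) : Option β :=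
    o.elim (some b) fun c => if f a b < f a c then some b else some c
  have hstep (a : α) : List.argAux (fun b c => f a b < f a c) = step a := by
    funext o b
    cases o <;> rfl
  have : PolyTime fun x : (α × Option β × β) × β => f x.1.1 x.1.2.2 :=
    hf.comp (f := fun x : (α × Option β × β) × β => (x.1.1, x.1.2.2)) (by fun_prop)
  have : PolyTime fun x : (α × Option β × β) × β => f x.1.1 x.2 :=
    hf.comp (f := fun x : (α × Option β × β) × β => (x.1.1, x.2)) (by fun_prop)
  have hfold : PolyTime fun a => (l a).foldl (step a) none :=
    list_foldl hl (const none) (by fun_prop) (B := fun a => treeSize (l a) + 2) (by fun_prop)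
      fun a p hp => by
        rw [← hstep]
        have := treeSize_le_of_prefix hp
        rcases hmin : p.argmin (f a) with _ | b
        · exact (congrArg treeSize hmin).trans_le (Nat.le_add_left 1 _)
        · have := treeSize_le_of_mem (List.argmin_mem hmin)
          refine (congrArg treeSize hmin).trans_le ?_
          rw [treeSize_some]
          omega
  exact hfold.of_eq fun a => by rw [List.argmin, hstep]

theorem exists_outputs {f : α → Data} (hf : PolyTime f) : ∃ (c : Cmd) (p : Polynomial ℕ),
    ∀ a, ∃ t ≤ p.eval (treeSize a), Outputs c (encode a) t (f a) := by
  obtain ⟨c, T, ⟨p, hT⟩, hc⟩ := hf 0 0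
  refine ⟨c, p, fun a => ?_⟩
  obtain ⟨t, ht, s, hrun, hs, -⟩ := hc (.init (encode a)) a (Function.update_self ..)
  exact ⟨t, ht.trans (hT a), s, hrun, hs⟩

end PolyTime

end TreeWhile

/-! ### Graphs labelled by letters -/

namespace SubgroupDistance

variable {α V W : Type*}

/-- The formal inverse of a letter of a group word. -/
def letterInv (a : α × Bool) : α × Bool := (a.1, !a.2)

/-- The labelled edges of a directed graph: `(p, a, q)` is an edge from `p` to `q` with the
letter `a` on it. A graph is given by the list of its edges. -/
abbrev Edge (α V : Type*) : Type _ := V × (α × Bool) × V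

/-- The image of a graph under a map of its vertices. -/
def mapEdges (f : V → W) (E : List (Edge α V)) : List (Edge α W) :=
  E.map fun e => (f e.1, e.2.1, f e.2.2)

/-- `Reach E b w q`: the word `w` labels a walk from `b` to `q`. Group elements act from the left,
so the walk reads `w` from right to left. -/
inductive Reach (E : List (Edge α V)) (b : V) : List (α × Bool) → V → Prop
  | nil : Reach E b [] b
  | cons {a : α × Bool} {w : List (α × Bool)} {p q : V} :
      (p, a, q) ∈ E → Reach E b w p → Reach E b (a :: w) q

/-- Every edge can be traversed backwards, with the inverse letter. -/
def IsSymm (E : List (Edge α V)) : Prop :=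
  ∀ p a q, (p, a, q) ∈ E → (q, letterInv a, p) ∈ E

/-- An edge is determined by its source and its letter; such graphs are called folded. -/
def IsFolded (E : List (Edge α V)) : Prop :=
  ∀ p a q q', (p, a, q) ∈ E → (p, a, q') ∈ E → q = q'

theorem letterInv_letterInv (a : α × Bool) : letterInv (letterInv a) = a := by
  simp only [letterInv, Bool.not_not]

theorem invRev_cons (a : α × Bool) (w : List (α × Bool)) :
    FreeGroup.invRev (a :: w) = FreeGroup.invRev w ++ [letterInv a] := by
  simp only [FreeGroup.invRev, List.map_cons, List.reverse_cons, letterInv]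

theorem IsSymm.mapEdges {E : List (Edge α V)} (hE : IsSymm E) (f : V → W) :
    IsSymm (mapEdges f E) := by
  intro p a q h
  obtain ⟨e, he, heq⟩ := List.mem_map.1 h
  cases heq
  exact List.mem_map_of_mem (hE _ _ _ he)

namespace Reach

variable {E F : List (Edge α V)} {b p q : V} {v w : List (α × Bool)}

theorem append (hw : Reach E b w p) (hv : Reach E p v q) : Reach E b (v ++ w) q := by
  induction hv with
  | nil => exact hw
  | cons he _ ih => exact .cons he ih

theorem exists_of_append (h : Reach E b (v ++ w) q) : ∃ p, Reach E b w p ∧ Reach E p v q := by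
  induction v generalizing q with
  | nil => exact ⟨q, h, .nil⟩
  | cons a v ih =>
    cases h with
    | cons he h =>
      obtain ⟨p, hw, hv⟩ := ih h
      exact ⟨p, hw, .cons he hv⟩

theorem mono (hEF : E ⊆ F) (h : Reach E b w q) : Reach F b w q := by
  induction h with
  | nil => exact .nil
  | cons he _ ih => exact .cons (hEF he) ih

theorem map (f : V → W) (h : Reach E b w q) :
    Reach (mapEdges f E) (f b) w (f q) := by
  induction h with
  | nil => exact .nil
  | cons he _ ih => exact .cons (List.mem_map_of_mem he) ih

theorem invRev (hE : IsSymm E) (h : Reach E b w q) : Reach E q (FreeGroup.invRev w) b := by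
  induction h with
  | nil => exact .nil
  | cons he _ ih =>
    rw [invRev_cons]
    exact (Reach.cons (hE _ _ _ he) .nil).append ih

theorem of_redStep (hsymm : IsSymm E) (hfold : IsFolded E) (h : Reach E b v q)
    (hstep : FreeGroup.Red.Step v w) : Reach E b w q := by
  obtain ⟨x, y, i, s⟩ := hstep
  obtain ⟨p, hp, hx⟩ := h.exists_of_append
  cases hp with
  | cons he hp =>
    cases hp with
    | cons he' hy =>
      have hback := hsymm _ _ _ he'
      rw [letterInv, Bool.not_not] at hback
      exact (hfold _ _ _ _ hback he ▸ hy).append hx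

theorem of_red (hsymm : IsSymm E) (hfold : IsFolded E) (h : Reach E b v q)
    (hred : FreeGroup.Red v w) : Reach E b w q := by
  induction hred with
  | refl => exact h
  | tail _ hstep ih => exact ih.of_redStep hsymm hfold hstep

end Reach

section Product

variable [DecidableEq α] {E : List (Edge α V)} {F : List (Edge α W)}

/-- The fibre product of two labelled graphs: pairs of edges with the same letter. -/
def prodEdges (E : List (Edge α V)) (F : List (Edge α W)) : List (Edge α (V × W)) :=
  ((E ×ˢ F).filter fun x => x.1.2.1 = x.2.2.1).map fun x =>
    ((x.1.1, x.2.1), x.1.2.1, (x.1.2.2, x.2.2.2))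

theorem mem_prodEdges {p q : V × W} {a : α × Bool} :
    (p, a, q) ∈ prodEdges E F ↔ (p.1, a, q.1) ∈ E ∧ (p.2, a, q.2) ∈ F := by
  simp only [prodEdges, List.mem_map, List.mem_filter, decide_eq_true_eq]
  constructor
  · rintro ⟨⟨⟨m, a, n⟩, m', a', n'⟩, ⟨hmem, hlabel⟩, heq⟩
    obtain rfl : a = a' := hlabel
    cases heq
    exact List.pair_mem_product.1 hmem
  · rintro ⟨he, hf⟩
    exact ⟨(_, _), ⟨List.pair_mem_product.2 ⟨he, hf⟩, rfl⟩, rfl⟩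

theorem reach_prodEdges {b q : V × W} {w : List (α × Bool)} :
    Reach (prodEdges E F) b w q ↔ Reach E b.1 w q.1 ∧ Reach F b.2 w q.2 := by
  constructor
  · intro h
    induction h with
    | nil => exact ⟨.nil, .nil⟩
    | cons he _ ih =>
      exact ⟨.cons (mem_prodEdges.1 he).1 ih.1, .cons (mem_prodEdges.1 he).2 ih.2⟩
  · induction w generalizing q with
    | nil =>
      rintro ⟨h, h'⟩
      obtain ⟨b, b'⟩ := b
      obtain ⟨q, q'⟩ := q
      cases h
      cases h'
      exact .nil
    | cons a w ih =>
      rintro ⟨h, h'⟩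
      cases h with
      | cons he h =>
        cases h' with
        | cons he' h' => exact .cons (mem_prodEdges.2 ⟨he, he'⟩) (ih (q := (_, _)) ⟨h, h'⟩)

end Product

/-! ### Shortest reduced words -/

theorem isReduced_cons_iff {a : α × Bool} {w : List (α × Bool)} :
    FreeGroup.IsReduced (a :: w) ↔ w.head? ≠ some (letterInv a) ∧ FreeGroup.IsReduced w := by
  cases w with
  | nil => simp
  | cons c w =>
    rw [FreeGroup.isReduced_cons_cons]
    refine and_congr_left fun _ => ?_
    obtain ⟨x, s⟩ := a
    obtain ⟨y, t⟩ := c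
    cases s <;> cases t <;> simp [letterInv, eq_comm]

/-- `ReducedWalk E b l q`: the list `l` of edges, the last one first, is a walk from `b` to `q` that
reads a reduced word. -/
inductive ReducedWalk (E : List (Edge α V)) (b : V) : List (Edge α V) → V → Prop
  | nil : ReducedWalk E b [] b
  | cons {e : Edge α V} {l : List (Edge α V)} : e ∈ E → ReducedWalk E b l e.1 →
      (l.map fun e => e.2.1).head? ≠ some (letterInv e.2.1) → ReducedWalk E b (e :: l) e.2.2

namespace ReducedWalk

variable {E : List (Edge α V)} {b q : V} {l : List (Edge α V)} {w : List (α × Bool)}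

theorem reach (h : ReducedWalk E b l q) : Reach E b (l.map fun e => e.2.1) q := by
  induction h with
  | nil => exact .nil
  | cons he _ _ ih => exact .cons he ih

theorem isReduced (h : ReducedWalk E b l q) : FreeGroup.IsReduced (l.map fun e => e.2.1) := by
  induction h with
  | nil => exact .nil
  | cons _ _ hhead ih => exact isReduced_cons_iff.2 ⟨hhead, ih⟩

theorem subset (h : ReducedWalk E b l q) : l ⊆ E := by
  induction h with
  | nil => exact List.nil_subset _
  | cons he _ _ ih => exact List.cons_subset.2 ⟨he, ih⟩

theorem of_append {k : List (Edge α V)} {e : Edge α V} (h : ReducedWalk E b (k ++ e :: l) q) :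
    ReducedWalk E b (e :: l) e.2.2 := by
  induction k generalizing q with
  | nil => cases h with
    | cons he h hhead => exact .cons he h hhead
  | cons f k ih => cases h with
    | cons _ h _ => exact ih h

/-- A walk that uses an edge twice is shortened by the part between its two uses. -/
theorem exists_nodup (h : ReducedWalk E b l q) :
    ∃ m, ReducedWalk E b m q ∧ m.Nodup ∧ m.head? = l.head? ∧ m.length ≤ l.length := by
  induction h with
  | nil => exact ⟨[], .nil, .nil, rfl, le_rfl⟩
  | @cons e l he _ hhead ih =>
    obtain ⟨m, hm, hnodup, hm_head, hm_length⟩ := ih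
    by_cases hem : e ∈ m
    · obtain ⟨k, m, rfl⟩ := List.append_of_mem hem
      refine ⟨e :: m, hm.of_append, hnodup.of_append_right, rfl, ?_⟩
      simp only [List.length_append, List.length_cons] at hm_length ⊢
      omega
    · refine ⟨e :: m, .cons he hm ?_, hnodup.cons hem, rfl, Nat.succ_le_succ hm_length⟩
      rwa [List.head?_map, hm_head, ← List.head?_map]

end ReducedWalk

theorem Reach.exists_reducedWalk {E : List (Edge α V)} {b q : V} {w : List (α × Bool)}
    (h : Reach E b w q) (hw : FreeGroup.IsReduced w) :
    ∃ l, ReducedWalk E b l q ∧ (l.map fun e => e.2.1) = w := by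
  induction h with
  | nil => exact ⟨[], .nil, rfl⟩
  | cons he _ ih =>
    obtain ⟨hhead, hw⟩ := isReduced_cons_iff.1 hw
    obtain ⟨l, hl, rfl⟩ := ih hw
    exact ⟨_, .cons he hl hhead, rfl⟩

theorem Reach.exists_length_le {E : List (Edge α V)} {b q : V} {w : List (α × Bool)}
    (h : Reach E b w q) (hw : FreeGroup.IsReduced w) :
    ∃ v, Reach E b v q ∧ FreeGroup.IsReduced v ∧ v.head? = w.head? ∧ v.length ≤ w.length ∧
      v.length ≤ E.length := by
  obtain ⟨l, hl, rfl⟩ := h.exists_reducedWalk hw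
  obtain ⟨m, hm, hnodup, hhead, hlength⟩ := hl.exists_nodup
  refine ⟨_, hm.reach, hm.isReduced, ?_, ?_, ?_⟩
  · rw [List.head?_map, List.head?_map, hhead]
  · rwa [List.length_map, List.length_map]
  · rw [List.length_map]
    exact (hnodup.subperm hm.subset).length_le

section ShortestWords

variable [DecidableEq α] [DecidableEq V] {E : List (Edge α V)} {b q : V} {w : List (α × Bool)}
  {T : List (V × List (α × Bool))}

/-- One round of the search for shortest reduced words, as in the Bellman–Ford algorithm. An entry
`(q, w)` of the table records that the reduced word `w` labels a walk from `b` to `q`; the round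
keeps, for every edge `e`, a shortest entry that `e` extends without cancellation. -/
def relax (E : List (Edge α V)) (b : V) (T : List (V × List (α × Bool))) :
    List (V × List (α × Bool)) :=
  (b, []) :: E.filterMap fun e =>
    ((T.filter fun t => t.1 = e.1 ∧ t.2.head? ≠ some (letterInv e.2.1)).argmin
      fun t => t.2.length).map fun t => (e.2.2, e.2.1 :: t.2)

/-- Shortest reduced words labelling walks from `b`, for every possible end and first letter. -/
def shortestWords (E : List (Edge α V)) (b : V) : List (V × List (α × Bool)) :=
  (relax E b)^[E.length + 1] []

theorem eq_or_exists_of_mem_relax (h : (q, w) ∈ relax E b T) :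
    (q, w) = (b, []) ∨ ∃ p a v, w = a :: v ∧ (p, a, q) ∈ E ∧ (p, v) ∈ T ∧
      v.head? ≠ some (letterInv a) := by
  refine (List.mem_cons.1 h).imp_right fun h => ?_
  obtain ⟨⟨p, a, q⟩, he, h⟩ := List.mem_filterMap.1 h
  obtain ⟨⟨p, v⟩, hmin, heq⟩ := Option.map_eq_some_iff.1 h
  obtain ⟨rfl, rfl⟩ := Prod.mk.inj heq
  obtain ⟨hT, hcond⟩ := List.mem_filter.1 (List.argmin_mem hmin)
  obtain ⟨rfl, hhead⟩ := of_decide_eq_true hcond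
  exact ⟨_, a, v, rfl, he, hT, hhead⟩

theorem exists_cons_mem_relax {p : V} {a : α × Bool} {v : List (α × Bool)} (he : (p, a, q) ∈ E)
    (hT : (p, v) ∈ T) (hhead : v.head? ≠ some (letterInv a)) :
    ∃ v', (q, a :: v') ∈ relax E b T ∧ v'.length ≤ v.length := by
  have hmem : (p, v) ∈ T.filter fun t => t.1 = p ∧ t.2.head? ≠ some (letterInv a) :=
    List.mem_filter.2 ⟨hT, decide_eq_true ⟨rfl, hhead⟩⟩
  obtain ⟨t, ht⟩ := Option.ne_none_iff_exists'.1
    (mt (List.argmin_eq_none (f := fun t => t.2.length)).1 (List.ne_nil_of_mem hmem))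
  have hle := List.le_of_mem_argmin hmem ht
  exact ⟨t.2, List.mem_cons_of_mem _ (List.mem_filterMap.2
    ⟨_, he, congrArg (Option.map fun t => (q, a :: t.2)) ht⟩), hle⟩

theorem reach_and_isReduced_of_mem_iterate_relax {n : ℕ} (h : (q, w) ∈ (relax E b)^[n] []) :
    Reach E b w q ∧ FreeGroup.IsReduced w := by
  induction n generalizing q w with
  | zero => exact absurd h List.not_mem_nil
  | succ n ih =>
    rw [Function.iterate_succ_apply'] at h
    obtain heq | ⟨p, a, v, rfl, he, hT, hhead⟩ := eq_or_exists_of_mem_relax h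
    · obtain ⟨rfl, rfl⟩ := Prod.mk.inj heq
      exact ⟨.nil, .nil⟩
    · exact ⟨.cons he (ih hT).1, isReduced_cons_iff.2 ⟨hhead, (ih hT).2⟩⟩

theorem exists_mem_iterate_relax {n : ℕ} (h : Reach E b w q) (hw : FreeGroup.IsReduced w)
    (hn : w.length < n) :
    ∃ v, (q, v) ∈ (relax E b)^[n] [] ∧ v.head? = w.head? ∧ v.length ≤ w.length := by
  induction n generalizing q w with
  | zero => exact absurd hn (Nat.not_lt_zero _)
  | succ n ih =>
    rw [Function.iterate_succ_apply']
    cases h with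
    | nil => exact ⟨[], List.mem_cons_self, rfl, le_rfl⟩
    | cons he h =>
      obtain ⟨hhead, hw⟩ := isReduced_cons_iff.1 hw
      obtain ⟨v, hv, hv_head, hv_length⟩ := ih h hw (Nat.lt_of_succ_lt_succ hn)
      obtain ⟨v', hv', hle⟩ := exists_cons_mem_relax (b := b) he hv (hv_head ▸ hhead)
      exact ⟨_, hv', rfl, Nat.succ_le_succ (hle.trans hv_length)⟩

theorem length_iterate_relax_le (E : List (Edge α V)) (b : V)
    (n : ℕ) : ((relax E b)^[n] []).length ≤ E.length + 1 := by
  cases n with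
  | zero => exact Nat.zero_le _
  | succ n =>
    rw [Function.iterate_succ_apply']
    exact Nat.succ_le_succ (List.length_filterMap_le _ _)

theorem reach_of_mem_shortestWords (h : (q, w) ∈ shortestWords E b) : Reach E b w q :=
  (reach_and_isReduced_of_mem_iterate_relax h).1

theorem isReduced_of_mem_shortestWords (h : (q, w) ∈ shortestWords E b) :
    FreeGroup.IsReduced w :=
  (reach_and_isReduced_of_mem_iterate_relax h).2

theorem exists_mem_shortestWords (h : Reach E b w q) (hw : FreeGroup.IsReduced w) :
    ∃ v, (q, v) ∈ shortestWords E b ∧ v.head? = w.head? ∧ v.length ≤ w.length := by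
  obtain ⟨v, hv, hv_red, hv_head, hv_length, hvE⟩ := h.exists_length_le hw
  obtain ⟨v', hv', hhead, hlength⟩ := exists_mem_iterate_relax hv hv_red (Nat.lt_succ_of_le hvE)
  exact ⟨v', hv', hhead.trans hv_head, hlength.trans hv_length⟩

end ShortestWords

/-! ### Folding -/

theorem iterate_of_measure_lt {S : Type*} {P : S → Prop} {f : S → S} {μ : S → ℕ}
    (hlt : ∀ x, ¬ P x → μ (f x) < μ x) (hP : ∀ x, P x → P (f x)) {n : ℕ} {x : S}
    (hn : μ x ≤ n) : P (f^[n] x) := by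
  induction n generalizing x with
  | zero => exact by_contra fun hx => ((hlt x hx).trans_le hn).not_ge (Nat.zero_le _)
  | succ n ih =>
    by_cases hx : P x
    · exact Function.Iterate.rec P hx hP (n + 1)
    · exact ih (Nat.le_of_lt_succ ((hlt x hx).trans_le hn))

section Folding

variable [DecidableEq V]

/-- The map that sends the vertex `x` to `y` and fixes all others. -/
def rename (x y v : V) : V := if v = x then y else v

theorem rename_self (x y : V) : rename x y x = y := if_pos rfl

theorem comp_rename {X : Type*} {φ : V → X} {x y : V} (h : φ x = φ y) (v : V) :
    φ (rename x y v) = φ v := by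
  by_cases hv : v = x
  · rw [hv, rename_self, h]
  · rw [rename, if_neg hv]

/-- The ends of the edges of a graph. -/
def targets (E : List (Edge α V)) : Finset V := (E.map fun e => e.2.2).toFinset

theorem mem_targets {E : List (Edge α V)} {p q : V} {a : α × Bool} (h : (p, a, q) ∈ E) :
    q ∈ targets E :=
  List.mem_toFinset.2 (List.mem_map.2 ⟨_, h, rfl⟩)

theorem card_targets_lt {E : List (Edge α V)} {x y : V} (hx : x ∈ targets E)
    (hy : y ∈ targets E) (hxy : x ≠ y) :
    (targets (mapEdges (rename x y) E)).card < (targets E).card := by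
  refine (Finset.card_le_card fun v hv => ?_).trans_lt (Finset.card_erase_lt_of_mem hx)
  rw [targets, List.mem_toFinset, mapEdges, List.map_map] at hv
  obtain ⟨⟨p, a, q⟩, he, rfl⟩ := List.mem_map.1 hv
  simp only [Function.comp_apply, rename]
  split_ifs with hq
  · exact Finset.mem_erase.2 ⟨hxy.symm, hy⟩
  · exact Finset.mem_erase.2 ⟨hq, mem_targets he⟩

variable [DecidableEq α]

/-- Identify the ends of two edges with the same source and the same letter, if there are two such
edges with different ends. The graph is given with a base vertex. -/
def foldStep (G : V × List (Edge α V)) : V × List (Edge α V) :=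
  ((G.2 ×ˢ G.2).find? fun x => x.1.1 = x.2.1 ∧ x.1.2.1 = x.2.2.1 ∧ x.1.2.2 ≠ x.2.2.2).elim G
    fun x => (rename x.1.2.2 x.2.2.2 G.1, mapEdges (rename x.1.2.2 x.2.2.2) G.2)

/-- Stallings' folding: identify ends of edges until the graph is folded. -/
def foldGraph (G : V × List (Edge α V)) : V × List (Edge α V) := foldStep^[G.2.length] G

theorem foldStep_eq (G : V × List (Edge α V)) : (IsFolded G.2 ∧ foldStep G = G) ∨
    ∃ p a q q', (p, a, q) ∈ G.2 ∧ (p, a, q') ∈ G.2 ∧ q ≠ q' ∧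
      foldStep G = (rename q q' G.1, mapEdges (rename q q') G.2) := by
  unfold foldStep
  cases hfind : (G.2 ×ˢ G.2).find? fun x =>
      x.1.1 = x.2.1 ∧ x.1.2.1 = x.2.2.1 ∧ x.1.2.2 ≠ x.2.2.2 with
  | none =>
    refine .inl ⟨fun p a q q' h h' => by_contra fun hne => ?_, rfl⟩
    exact List.find?_eq_none.1 hfind _ (List.pair_mem_product.2 ⟨h, h'⟩)
      (decide_eq_true ⟨rfl, rfl, hne⟩)
  | some x =>
    obtain ⟨⟨p, a, q⟩, p', a', q'⟩ := x
    obtain ⟨h, h'⟩ := List.pair_mem_product.1 (List.mem_of_find?_eq_some hfind)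
    have hconflict := List.find?_some hfind
    obtain ⟨hp, ha, hne⟩ := of_decide_eq_true hconflict
    cases hp
    cases ha
    exact .inr ⟨_, _, _, _, h, h', hne, rfl⟩

theorem isFolded_foldGraph (G : V × List (Edge α V)) : IsFolded (foldGraph G).2 := by
  refine iterate_of_measure_lt (P := fun G : V × List (Edge α V) => IsFolded G.2)
    (μ := fun G => (targets G.2).card) (fun G hG => ?_) (fun G hG => ?_)
    ((List.toFinset_card_le _).trans_eq (List.length_map _))
  · obtain ⟨hfold, -⟩ | ⟨p, a, q, q', h, h', hne, hstep⟩ := foldStep_eq G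
    · exact absurd hfold hG
    · rw [hstep]
      exact card_targets_lt (mem_targets h) (mem_targets h') hne
  · obtain ⟨-, hstep⟩ | ⟨p, a, q, q', h, h', hne, -⟩ := foldStep_eq G
    · rwa [hstep]
    · exact absurd (hG _ _ _ _ h h') hne

theorem iterate_foldStep_induction {P : V × List (Edge α V) → Prop} {G : V × List (Edge α V)}
    (hG : P G) (hstep : ∀ b E p a q q', (p, a, q) ∈ E → (p, a, q') ∈ E → P (b, E) →
      P (rename q q' b, mapEdges (rename q q') E)) (n : ℕ) : P (foldStep^[n] G) := by
  refine Function.Iterate.rec P hG (fun G hG => ?_) n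
  obtain ⟨-, heq⟩ | ⟨p, a, q, q', h, h', -, heq⟩ := foldStep_eq G
  · rwa [heq]
  · rw [heq]
    exact hstep _ _ _ _ _ _ h h' hG

end Folding

/-! ### Stallings graphs -/

/-- A labelling of the vertices by elements of a `FreeGroup α`-set along which every edge acts as
its letter. -/
def IsLabelling {X : Type*} [MulAction (FreeGroup α) X] (φ : V → X) (E : List (Edge α V)) : Prop :=
  ∀ e ∈ E, φ e.2.2 = FreeGroup.mk [e.2.1] • φ e.1

namespace IsLabelling

variable {X : Type*} [MulAction (FreeGroup α) X] {φ : V → X} {E : List (Edge α V)}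

theorem eq_smul (hφ : IsLabelling φ E) {b q : V} {w : List (α × Bool)} (h : Reach E b w q) :
    φ q = FreeGroup.mk w • φ b := by
  induction h with
  | nil => exact (one_smul _ _).symm
  | cons he _ ih => rw [hφ _ he, ih, smul_smul, FreeGroup.mul_mk]; rfl

theorem mapEdges_rename [DecidableEq V] (hφ : IsLabelling φ E) {x y : V} (h : φ x = φ y) :
    IsLabelling φ (mapEdges (rename x y) E) := fun e he => by
  obtain ⟨f, hf, rfl⟩ := List.mem_map.1 he
  simp only [comp_rename h, hφ f hf]

end IsLabelling

/-- Add to every edge the reverse edge with the inverse letter. -/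
def symmetrize (E : List (Edge α V)) : List (Edge α V) :=
  E ++ E.map fun e => (e.2.2, letterInv e.2.1, e.1)

theorem isSymm_symmetrize (E : List (Edge α V)) : IsSymm (symmetrize E) := fun p a q h => by
  obtain h | h := List.mem_append.1 h
  · exact List.mem_append_right _ (List.mem_map_of_mem (f := fun e : Edge α V => _) h)
  · obtain ⟨e, he, heq⟩ := List.mem_map.1 h
    cases heq
    rw [letterInv_letterInv]
    exact List.mem_append_left _ he

theorem IsLabelling.symmetrize {X : Type*} [MulAction (FreeGroup α) X] {φ : V → X}
    {E : List (Edge α V)} (hφ : IsLabelling φ E) : IsLabelling φ (symmetrize E) := fun e he => by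
  obtain he | he := List.mem_append.1 he
  · exact hφ e he
  · obtain ⟨f, hf, rfl⟩ := List.mem_map.1 he
    exact eq_inv_smul_iff.2 (hφ f hf).symm

/-- The path that reads a word, from the empty word along its suffixes. -/
def pathEdges : List (α × Bool) → List (Edge α (List (α × Bool)))
  | [] => []
  | a :: w => (w, a, a :: w) :: pathEdges w

theorem exists_suffix_of_mem_pathEdges {w : List (α × Bool)} {e : Edge α (List (α × Bool))}
    (he : e ∈ pathEdges w) : ∃ a v, e = (v, a, a :: v) ∧ a :: v <:+ w := by
  induction w with
  | nil => exact absurd he List.not_mem_nil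
  | cons a w ih =>
    obtain rfl | he := List.mem_cons.1 he
    · exact ⟨a, w, rfl, List.suffix_rfl⟩
    · obtain ⟨a', v, rfl, hv⟩ := ih he
      exact ⟨a', v, rfl, hv.trans (List.suffix_cons a w)⟩

theorem length_pathEdges (w : List (α × Bool)) : (pathEdges w).length = w.length := by
  induction w with
  | nil => rfl
  | cons a w ih => rw [pathEdges, List.length_cons, ih, List.length_cons]

theorem reach_pathEdges (w : List (α × Bool)) : Reach (pathEdges w) [] w w := by
  induction w with
  | nil => exact .nil
  | cons a w ih => exact .cons List.mem_cons_self (ih.mono (List.subset_cons_self _ _))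

theorem isLabelling_pathEdges (H : Subgroup (FreeGroup α)) (w : List (α × Bool)) :
    IsLabelling (fun v => (FreeGroup.mk v : FreeGroup α ⧸ H)) (pathEdges w) := by
  induction w with
  | nil => exact fun _ h => absurd h List.not_mem_nil
  | cons a w ih => exact List.forall_mem_cons.2 ⟨rfl, ih⟩

section Stallings

variable [DecidableEq α]

/-- The loop at the empty word that reads a word. -/
def loopEdges (w : List (α × Bool)) : List (Edge α (List (α × Bool))) :=
  mapEdges (rename w []) (pathEdges w)

/-- The Stallings graph of the subgroup generated by a list of words, with its base vertex: a
bouquet of loops that read the generators, folded. -/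
def stallings (L : List (List (α × Bool))) :
    List (α × Bool) × List (Edge α (List (α × Bool))) :=
  foldGraph ([], symmetrize (L.flatMap loopEdges))

/-- A graph with a base vertex recognizes a subgroup if its loops at the base vertex represent
elements of the subgroup, and every element of the subgroup is represented by such a loop that
reads its reduced word. -/
structure Recognizes (G : V × List (Edge α V)) (H : Subgroup (FreeGroup α)) : Prop where
  isSymm : IsSymm G.2
  reach_toWord : ∀ g ∈ H, Reach G.2 G.1 g.toWord G.1
  inv_mul_mem : ∀ {z w q}, Reach G.2 G.1 z q → Reach G.2 G.1 w q →
    (FreeGroup.mk z)⁻¹ * FreeGroup.mk w ∈ H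

theorem isSymm_stallings (L : List (List (α × Bool))) : IsSymm (stallings L).2 :=
  iterate_foldStep_induction (P := fun G => IsSymm G.2) (isSymm_symmetrize _)
    (fun _ _ _ _ _ _ _ _ hE => hE.mapEdges _) _

theorem reach_stallings {L : List (List (α × Bool))} {w : List (α × Bool)} (hw : w ∈ L) :
    Reach (stallings L).2 (stallings L).1 w (stallings L).1 := by
  refine iterate_foldStep_induction (P := fun G => Reach G.2 G.1 w G.1) ?_
    (fun _ _ _ _ _ _ _ _ h => h.map _) _
  have hloop := (reach_pathEdges w).map (rename w [])
  rw [rename_self] at hloop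
  have hbase : rename w [] [] = [] := by rw [rename, ite_self]
  rw [hbase] at hloop
  exact hloop.mono fun e he => List.mem_append_left _ (List.mem_flatMap.2 ⟨w, hw, he⟩)

theorem reach_toWord_of_mem_closure {E : List (Edge α V)} {b : V} (hsymm : IsSymm E)
    (hfold : IsFolded E) {L : List (List (α × Bool))} (hL : ∀ w ∈ L, Reach E b w b)
    {g : FreeGroup α} (hg : g ∈ Subgroup.closure {g | ∃ w ∈ L, FreeGroup.mk w = g}) :
    Reach E b g.toWord b := by
  induction hg using Subgroup.closure_induction with
  | mem g hg =>
    obtain ⟨w, hw, rfl⟩ := hg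
    exact (hL w hw).of_red hsymm hfold FreeGroup.reduce.red
  | one => exact FreeGroup.toWord_one (α := α) ▸ .nil
  | mul g h _ _ hg hh =>
    rw [FreeGroup.toWord_mul]
    exact (hh.append hg).of_red hsymm hfold FreeGroup.reduce.red
  | inv g _ hg =>
    rw [FreeGroup.toWord_inv]
    exact hg.invRev hsymm

theorem exists_isLabelling_stallings {L : List (List (α × Bool))} {H : Subgroup (FreeGroup α)}
    (hL : ∀ w ∈ L, FreeGroup.mk w ∈ H) :
    ∃ φ : List (α × Bool) → FreeGroup α ⧸ H,
      IsLabelling φ (stallings L).2 ∧ φ (stallings L).1 = (1 : FreeGroup α) := by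
  let φ (v : List (α × Bool)) : FreeGroup α ⧸ H := FreeGroup.mk v
  refine ⟨φ, iterate_foldStep_induction
    (P := fun G => IsLabelling φ G.2 ∧ φ G.1 = (1 : FreeGroup α)) ⟨?_, rfl⟩ ?_ _⟩
  · refine IsLabelling.symmetrize fun e he => ?_
    obtain ⟨w, hw, he⟩ := List.mem_flatMap.1 he
    have hloop : φ w = φ [] := (QuotientGroup.eq.2 (by simpa using hL w hw)).symm
    exact (isLabelling_pathEdges H w).mapEdges_rename hloop e he
  · rintro b E p a q q' hq hq' ⟨hφ, hb⟩
    have heq : φ q = φ q' := (hφ _ hq).trans (hφ _ hq').symm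
    exact ⟨hφ.mapEdges_rename heq, (comp_rename heq b).trans hb⟩

theorem recognizes_stallings (L : List (List (α × Bool))) :
    Recognizes (stallings L) (Subgroup.closure {g | ∃ w ∈ L, FreeGroup.mk w = g}) where
  isSymm := isSymm_stallings L
  reach_toWord _ := reach_toWord_of_mem_closure (isSymm_stallings L) (isFolded_foldGraph _)
    fun _ => reach_stallings
  inv_mul_mem {z w q} hz hw := by
    obtain ⟨φ, hφ, hbase⟩ := exists_isLabelling_stallings
      (H := Subgroup.closure {g | ∃ w ∈ L, FreeGroup.mk w = g}) fun w hw =>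
        Subgroup.subset_closure ⟨w, hw, rfl⟩
    have hcoset := (hφ.eq_smul hz).symm.trans (hφ.eq_smul hw)
    rw [hbase] at hcoset
    simpa [QuotientGroup.eq] using hcoset

end Stallings

/-! ### Closest pairs -/

/-- Two lists have no common prefix, except for the empty one. -/
abbrev Diverge {β : Type*} (v w : List β) : Prop := v = [] ∨ v.head? ≠ w.head?

theorem exists_append_diverge {β : Type*} (x y : List β) :
    ∃ u v w, x = u ++ v ∧ y = u ++ w ∧ Diverge v w := by
  induction x generalizing y with
  | nil => exact ⟨[], [], y, rfl, rfl, .inl rfl⟩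
  | cons a x ih =>
    by_cases hy : y.head? = some a
    · obtain ⟨y, rfl⟩ := List.head?_eq_some_iff.1 hy
      obtain ⟨u, v, w, rfl, rfl, hvw⟩ := ih y
      exact ⟨a :: u, v, w, rfl, rfl, hvw⟩
    · exact ⟨[], a :: x, y, rfl, rfl, .inr (Ne.symm hy)⟩

theorem isReduced_invRev_append {v w : List (α × Bool)} (hv : FreeGroup.IsReduced v)
    (hw : FreeGroup.IsReduced w) (h : Diverge v w) :
    FreeGroup.IsReduced (FreeGroup.invRev v ++ w) := by
  induction v generalizing w with
  | nil => exact hw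
  | cons a v ih =>
    rw [invRev_cons, List.append_assoc]
    obtain ⟨hhead, hv⟩ := isReduced_cons_iff.1 hv
    refine ih hv (isReduced_cons_iff.2 ⟨?_, hw⟩) (.inr hhead)
    rw [letterInv_letterInv]
    exact (h.resolve_left (List.cons_ne_nil a v)).symm

theorem isReduced_invRev {v : List (α × Bool)} (hv : FreeGroup.IsReduced v) :
    FreeGroup.IsReduced (FreeGroup.invRev v) := by
  cases v with
  | nil => exact hv
  | cons a v =>
    simpa using isReduced_invRev_append (w := []) hv .nil (.inr (Option.some_ne_none a))

theorem mk_invRev_append (v w : List (α × Bool)) :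
    FreeGroup.mk (FreeGroup.invRev v ++ w) = (FreeGroup.mk v)⁻¹ * FreeGroup.mk w := by
  rw [← FreeGroup.mul_mk, FreeGroup.inv_mk]

section Search

variable [DecidableEq α]

theorem norm_inv_mul_mk_append (u : List (α × Bool)) {v w : List (α × Bool)}
    (hv : FreeGroup.IsReduced v) (hw : FreeGroup.IsReduced w) (h : Diverge v w) :
    ((FreeGroup.mk (u ++ v))⁻¹ * FreeGroup.mk (u ++ w)).norm = (v ++ w).length := by
  rw [← FreeGroup.mul_mk, ← FreeGroup.mul_mk, mul_inv_rev, mul_assoc, inv_mul_cancel_left,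
    ← mk_invRev_append, FreeGroup.norm, FreeGroup.toWord_mk,
    (isReduced_invRev_append hv hw h).reduce_eq, List.length_append, FreeGroup.invRev_length,
    List.length_append]

variable [DecidableEq V] [DecidableEq W]

/-- The triples `(z, v, w)` of reduced words, not all empty, that the search finds: `z` leads from
the base vertices to a pair of vertices, and `v`, `w` lead to the components of this pair. The
pair `(z⁻¹ v, z⁻¹ w)` then belongs to the two subgroups, and its distance is `|v| + |w|`. -/
def candidates (G : V × List (Edge α V)) (G' : W × List (Edge α W)) :
    List (List (α × Bool) × List (α × Bool) × List (α × Bool)) :=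
  ((shortestWords (prodEdges G.2 G'.2) (G.1, G'.1) ×ˢ
    (shortestWords G.2 G.1 ×ˢ shortestWords G'.2 G'.1)).filter fun x =>
      x.1.1 = (x.2.1.1, x.2.2.1) ∧ Diverge x.2.1.2 x.2.2.2 ∧ x.1.2 ++ x.2.1.2 ++ x.2.2.2 ≠ []).map
    fun x => (x.1.2, x.2.1.2, x.2.2.2)

variable {G : V × List (Edge α V)} {G' : W × List (Edge α W)} {H K : Subgroup (FreeGroup α)}
  {z v w : List (α × Bool)}

theorem mem_candidates : (z, v, w) ∈ candidates G G' ↔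
    (∃ p p', ((p, p'), z) ∈ shortestWords (prodEdges G.2 G'.2) (G.1, G'.1) ∧
      (p, v) ∈ shortestWords G.2 G.1 ∧ (p', w) ∈ shortestWords G'.2 G'.1) ∧
      Diverge v w ∧ z ++ v ++ w ≠ [] := by
  simp only [candidates, List.mem_map, List.mem_filter, decide_eq_true_eq]
  constructor
  · rintro ⟨⟨⟨s, z⟩, ⟨p, v⟩, p', w⟩, ⟨hmem, hs, hvw, hne⟩, heq⟩
    cases heq
    obtain rfl : s = (p, p') := hs
    obtain ⟨hz, hmem⟩ := List.pair_mem_product.1 hmem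
    obtain ⟨hv, hw⟩ := List.pair_mem_product.1 hmem
    exact ⟨⟨p, p', hz, hv, hw⟩, hvw, hne⟩
  · rintro ⟨⟨p, p', hz, hv, hw⟩, hvw, hne⟩
    exact ⟨_, ⟨List.pair_mem_product.2 ⟨hz, List.pair_mem_product.2 ⟨hv, hw⟩⟩, rfl, hvw, hne⟩, rfl⟩

theorem mem_of_mem_candidates (hG : Recognizes G H) (hG' : Recognizes G' K)
    (h : (z, v, w) ∈ candidates G G') :
    FreeGroup.mk (FreeGroup.invRev z ++ v) ∈ H ∧ FreeGroup.mk (FreeGroup.invRev z ++ w) ∈ K := by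
  obtain ⟨⟨p, p', hz, hv, hw⟩, -⟩ := mem_candidates.1 h
  obtain ⟨hz, hz'⟩ := reach_prodEdges.1 (reach_of_mem_shortestWords hz)
  rw [mk_invRev_append, mk_invRev_append]
  exact ⟨hG.inv_mul_mem hz (reach_of_mem_shortestWords hv),
    hG'.inv_mul_mem hz' (reach_of_mem_shortestWords hw)⟩

theorem not_eq_one_of_mem_candidates (h : (z, v, w) ∈ candidates G G') :
    ¬ (FreeGroup.mk (FreeGroup.invRev z ++ v) = 1 ∧
      FreeGroup.mk (FreeGroup.invRev z ++ w) = 1) := by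
  obtain ⟨⟨p, p', hz, hv, hw⟩, hvw, hne⟩ := mem_candidates.1 h
  rintro ⟨hv_one, hw_one⟩
  have hz_red := isReduced_of_mem_shortestWords hz
  have eq_of_mk {x : List (α × Bool)} (hx : FreeGroup.IsReduced x)
      (hx_one : FreeGroup.mk (FreeGroup.invRev z ++ x) = 1) : x = z := by
    rw [mk_invRev_append, inv_mul_eq_one] at hx_one
    rw [← hx.reduce_eq, ← hz_red.reduce_eq, ← FreeGroup.toWord_mk, ← FreeGroup.toWord_mk, hx_one]
  obtain rfl := eq_of_mk (isReduced_of_mem_shortestWords hv) hv_one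
  obtain rfl := eq_of_mk (isReduced_of_mem_shortestWords hw) hw_one
  obtain rfl := hvw.resolve_right fun hhead => hhead rfl
  exact hne rfl

theorem norm_of_mem_candidates (h : (z, v, w) ∈ candidates G G') :
    ((FreeGroup.mk (FreeGroup.invRev z ++ v))⁻¹ *
      FreeGroup.mk (FreeGroup.invRev z ++ w)).norm = (v ++ w).length := by
  obtain ⟨⟨p, p', -, hv, hw⟩, hvw, -⟩ := mem_candidates.1 h
  exact norm_inv_mul_mk_append _ (isReduced_of_mem_shortestWords hv)
    (isReduced_of_mem_shortestWords hw) hvw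

theorem exists_mem_candidates_of_reach {E : List (Edge α V)} {F : List (Edge α W)} {b p : V}
    {b' p' : W} (hz : FreeGroup.IsReduced z) (hv : FreeGroup.IsReduced v)
    (hw : FreeGroup.IsReduced w) (hzp : Reach E b z p) (hzp' : Reach F b' z p')
    (hvp : Reach E b v p) (hwp' : Reach F b' w p') (hvw : Diverge v w) (hne : z ++ v ++ w ≠ []) :
    ∃ z' v' w', (z', v', w') ∈ candidates (b, E) (b', F) ∧
      (v' ++ w').length ≤ (v ++ w).length := by
  obtain ⟨z', hz', hz'_head, -⟩ := exists_mem_shortestWords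
    ((reach_prodEdges (b := (b, b')) (q := (p, p'))).2 ⟨hzp, hzp'⟩) hz
  obtain ⟨v', hv', hv'_head, hv'_length⟩ := exists_mem_shortestWords hvp hv
  obtain ⟨w', hw', hw'_head, hw'_length⟩ := exists_mem_shortestWords hwp' hw
  have nil_iff {x y : List (α × Bool)} (h : x.head? = y.head?) : x = [] ↔ y = [] := by
    rw [← List.head?_eq_none_iff, h, List.head?_eq_none_iff]
  refine ⟨z', v', w', mem_candidates.2 ⟨⟨p, p', hz', hv', hw'⟩, ?_, ?_⟩, ?_⟩
  · rwa [Diverge, hv'_head, hw'_head, nil_iff hv'_head]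
  · rwa [Ne, List.append_eq_nil_iff, List.append_eq_nil_iff, nil_iff hz'_head, nil_iff hv'_head,
      nil_iff hw'_head, ← List.append_eq_nil_iff, ← List.append_eq_nil_iff]
  · simpa only [List.length_append] using add_le_add hv'_length hw'_length

theorem exists_mem_candidates_of_mem (hG : Recognizes G H) (hG' : Recognizes G' K)
    {h k : FreeGroup α} (hh : h ∈ H) (hk : k ∈ K) (hhk : ¬ (h = 1 ∧ k = 1)) :
    ∃ z v w, (z, v, w) ∈ candidates G G' ∧ (v ++ w).length ≤ (h⁻¹ * k).norm := by
  obtain ⟨u, v, w, hh_word, hk_word, hvw⟩ := exists_append_diverge h.toWord k.toWord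
  have hh_red : FreeGroup.IsReduced (u ++ v) := hh_word ▸ FreeGroup.isReduced_toWord
  have hk_red : FreeGroup.IsReduced (u ++ w) := hk_word ▸ FreeGroup.isReduced_toWord
  obtain ⟨p, hv, hu⟩ := (hh_word ▸ hG.reach_toWord h hh).exists_of_append
  obtain ⟨p', hw, hu'⟩ := (hk_word ▸ hG'.reach_toWord k hk).exists_of_append
  have hv_red := hh_red.infix (List.suffix_append u v).isInfix
  have hw_red := hk_red.infix (List.suffix_append u w).isInfix
  have hne : FreeGroup.invRev u ++ v ++ w ≠ [] := fun hnil => by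
    rw [List.append_eq_nil_iff, List.append_eq_nil_iff] at hnil
    obtain ⟨⟨hu_nil, rfl⟩, rfl⟩ := hnil
    obtain rfl := FreeGroup.invRev_injective (hu_nil.trans FreeGroup.invRev_empty.symm)
    exact hhk ⟨FreeGroup.toWord_eq_nil_iff.1 hh_word, FreeGroup.toWord_eq_nil_iff.1 hk_word⟩
  obtain ⟨z, v', w', hmem, hle⟩ := exists_mem_candidates_of_reach
    (isReduced_invRev (hh_red.infix (List.prefix_append u v).isInfix)) hv_red hw_red
    (hu.invRev hG.isSymm) (hu'.invRev hG'.isSymm) hv hw hvw hne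
  refine ⟨z, v', w', hmem, hle.trans_eq ?_⟩
  rw [← norm_inv_mul_mk_append u hv_red hw_red hvw, ← hh_word, ← hk_word, FreeGroup.mk_toWord,
    FreeGroup.mk_toWord]

end Search

/-- A closest pair of elements of the subgroups generated by two lists of words, if there is one. -/
def solve {r : ℕ} (L M : List (Word r)) : Option (Word r × Word r) :=
  ((candidates (stallings L) (stallings M)).argmin fun x => (x.2.1 ++ x.2.2).length).map
    fun x => (FreeGroup.invRev x.1 ++ x.2.1, FreeGroup.invRev x.1 ++ x.2.2)

theorem isAnswer_solve {r : ℕ} (L M : List (Word r)) :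
    IsAnswer (subgroupOf L) (subgroupOf M) (solve L M) := by
  have hL : Recognizes (stallings L) (subgroupOf L) := recognizes_stallings L
  have hM : Recognizes (stallings M) (subgroupOf M) := recognizes_stallings M
  unfold solve
  cases hmin : (candidates (stallings L) (stallings M)).argmin
      fun x => (x.2.1 ++ x.2.2).length with
  | none =>
    refine fun h hh k hk => by_contra fun hhk => ?_
    obtain ⟨z, v, w, hmem, -⟩ := exists_mem_candidates_of_mem hL hM hh hk hhk
    exact List.ne_nil_of_mem hmem (List.argmin_eq_none.1 hmin)
  | some x =>
    have hx := List.argmin_mem hmin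
    refine ⟨(mem_of_mem_candidates hL hM hx).1, (mem_of_mem_candidates hL hM hx).2,
      not_eq_one_of_mem_candidates hx, fun h hh k hk hhk => ?_⟩
    obtain ⟨z, v, w, hmem, hle⟩ := exists_mem_candidates_of_mem hL hM hh hk hhk
    rw [wordDist, wordDist, wordLength_eq_norm, wordLength_eq_norm, norm_of_mem_candidates hx]
    have hargmin := List.le_of_mem_argmin hmem hmin
    exact hargmin.trans hle

/-! ### Running time -/

section RunningTime

open TreeWhile

variable {ι : Type*} [TreeEncodable ι] [TreeEncodable α] [TreeEncodable V] [TreeEncodable W]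

@[fun_prop]
theorem polyTime_letterInv {a : ι → α × Bool} (ha : PolyTime a) :
    PolyTime fun i => letterInv (a i) := by
  have hcond : PolyTime fun i => ((a i).1, bif (a i).2 then false else true) := by fun_prop
  exact hcond.of_eq fun i => by rw [Bool.cond_false_left, Bool.and_true]; rfl

@[fun_prop]
theorem polyTime_invRev {w : ι → List (α × Bool)} (hw : PolyTime w) :
    PolyTime fun i => FreeGroup.invRev (w i) := by
  change PolyTime fun i => ((w i).map letterInv).reverse
  fun_prop

@[fun_prop]
theorem polyTime_prodEdges [DecidableEq α] {E : ι → List (Edge α V)} {F : ι → List (Edge α W)}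
    (hE : PolyTime E) (hF : PolyTime F) : PolyTime fun i => prodEdges (E i) (F i) := by
  unfold prodEdges
  fun_prop

@[fun_prop]
theorem polyTime_mapEdges {f : ι → V → W} {E : ι → List (Edge α V)}
    (hf : PolyTime fun x : ι × V => f x.1 x.2) (hE : PolyTime E) :
    PolyTime fun i => mapEdges (f i) (E i) := by
  unfold mapEdges
  fun_prop

@[fun_prop]
theorem polyTime_rename [DecidableEq V] {x y v : ι → V} (hx : PolyTime x) (hy : PolyTime y)
    (hv : PolyTime v) : PolyTime fun i => rename (x i) (y i) (v i) := by
  unfold rename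
  fun_prop

@[fun_prop]
theorem polyTime_symmetrize {E : ι → List (Edge α V)} (hE : PolyTime E) :
    PolyTime fun i => symmetrize (E i) := by
  unfold symmetrize
  fun_prop

theorem polyTime_foldStep [DecidableEq α] [DecidableEq V] :
    PolyTime (foldStep : V × List (Edge α V) → _) := by
  unfold foldStep
  fun_prop

theorem treeSize_edges_le {E : List (Edge α V)} {B : ℕ}
    (h : ∀ e ∈ E, treeSize e.1 ≤ B ∧ treeSize e.2.1 ≤ B ∧ treeSize e.2.2 ≤ B) :
    treeSize E ≤ E.length * (3 * B + 3) + 1 :=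
  treeSize_le_of_forall_mem fun ⟨p, a, q⟩ he => by
    obtain ⟨hp, ha, hq⟩ := h _ he
    simp only [treeSize_mk] at *
    omega

theorem treeSize_edge_le {E : List (Edge α V)} {e : Edge α V} (he : e ∈ E) :
    treeSize e.1 ≤ treeSize E ∧ treeSize e.2.1 ≤ treeSize E ∧ treeSize e.2.2 ≤ treeSize E := by
  have hE := treeSize_le_of_mem he
  obtain ⟨p, a, q⟩ := e
  simp only [treeSize_mk] at hE ⊢
  omega

theorem treeSize_iterate_foldStep_le [DecidableEq α] [DecidableEq V] (G : V × List (Edge α V))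
    (n : ℕ) : treeSize (foldStep^[n] G) ≤
      treeSize G + (treeSize G * (3 * treeSize G + 3) + 1) + 1 := by
  have hinv : (foldStep^[n] G).2.length = G.2.length ∧
      treeSize (foldStep^[n] G).1 ≤ treeSize G ∧ ∀ e ∈ (foldStep^[n] G).2,
        treeSize e.1 ≤ treeSize G ∧ treeSize e.2.1 ≤ treeSize G ∧ treeSize e.2.2 ≤ treeSize G := by
    refine iterate_foldStep_induction (P := fun G' => G'.2.length = G.2.length ∧
      treeSize G'.1 ≤ treeSize G ∧ ∀ e ∈ G'.2, treeSize e.1 ≤ treeSize G ∧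
        treeSize e.2.1 ≤ treeSize G ∧ treeSize e.2.2 ≤ treeSize G)
      ⟨rfl, treeSize_fst_le G, fun e he => ?_⟩ ?_ n
    · have hle := treeSize_snd_le G
      exact (treeSize_edge_le he).imp hle.trans' (And.imp hle.trans' hle.trans')
    · rintro b E p a q q' - hq' ⟨hlength, hb, hE⟩
      have hrename {v : V} (hv : treeSize v ≤ treeSize G) :
          treeSize (rename q q' v) ≤ treeSize G := by
        unfold rename
        split_ifs
        exacts [(hE _ hq').2.2, hv]
      refine ⟨(List.length_map _).trans hlength, hrename hb, fun e he => ?_⟩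
      obtain ⟨f, hf, rfl⟩ := List.mem_map.1 he
      exact (hE f hf).imp hrename (And.imp_right hrename)
  obtain ⟨hlength, hbase, hedges⟩ := hinv
  have hE := treeSize_edges_le hedges
  have hG := (length_lt_treeSize G.2).le.trans (treeSize_snd_le G)
  rw [← Prod.eta (foldStep^[n] G), treeSize_mk]
  rw [hlength] at hE
  have := Nat.mul_le_mul_right (3 * treeSize G + 3) hG
  omega

@[fun_prop]
theorem polyTime_foldGraph [DecidableEq α] [DecidableEq V] {G : ι → V × List (Edge α V)}
    (hG : PolyTime G) : PolyTime fun i => foldGraph (G i) := by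
  unfold foldGraph
  exact PolyTime.nat_iterate (f := fun _ => foldStep) (by fun_prop)
    (polyTime_foldStep.comp (by fun_prop)) hG (B := fun i =>
      treeSize (G i) + (treeSize (G i) * (3 * treeSize (G i) + 3) + 1) + 1) (by fun_prop)
    fun i n _ => treeSize_iterate_foldStep_le (G i) n

theorem treeSize_pathEdges_le (w : List (α × Bool)) :
    treeSize (pathEdges w) ≤ treeSize w * (3 * treeSize w + 3) + 1 := by
  have hle : treeSize (pathEdges w) ≤ (pathEdges w).length * (3 * treeSize w + 3) + 1 :=
    treeSize_edges_le fun e he => by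
      obtain ⟨a, v, rfl, hv⟩ := exists_suffix_of_mem_pathEdges he
      have := treeSize_le_of_suffix hv
      simp only [treeSize_cons] at this ⊢
      omega
  rw [length_pathEdges] at hle
  exact hle.trans (by gcongr; exact (length_lt_treeSize w).le)

@[fun_prop]
theorem polyTime_pathEdges {w : ι → List (α × Bool)} (hw : PolyTime w) :
    PolyTime fun i => pathEdges (w i) := by
  have hfoldr (w : List (α × Bool)) : w.foldr (fun a x => (a :: x.1, (x.1, a, a :: x.1) :: x.2))
      (([] : List (α × Bool)), []) = (w, pathEdges w) := by
    induction w with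
    | nil => rfl
    | cons a w ih => rw [List.foldr_cons, ih, pathEdges]
  have hpath : PolyTime fun i => ((w i).foldr (fun a x => (a :: x.1, (x.1, a, a :: x.1) :: x.2))
      (([] : List (α × Bool)), ([] : List (Edge α (List (α × Bool)))))).2 := by
    refine PolyTime.snd (.list_foldr hw (.const _) (by fun_prop) (B := fun i =>
      treeSize (w i) + (treeSize (w i) * (3 * treeSize (w i) + 3) + 1) + 1) (by fun_prop)
      fun i q hq => ?_)
    have hq_le := treeSize_le_of_suffix hq
    rw [hfoldr, treeSize_mk]
    gcongr
    exact (treeSize_pathEdges_le q).trans (by gcongr)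
  simpa only [hfoldr] using hpath

@[fun_prop]
theorem polyTime_stallings [DecidableEq α] {L : ι → List (List (α × Bool))} (hL : PolyTime L) :
    PolyTime fun i => stallings (L i) := by
  unfold stallings loopEdges
  fun_prop

@[fun_prop]
theorem polyTime_relax [DecidableEq α] [DecidableEq V] {E : ι → List (Edge α V)} {b : ι → V}
    {T : ι → List (V × List (α × Bool))} (hE : PolyTime E) (hb : PolyTime b) (hT : PolyTime T) :
    PolyTime fun i => relax (E i) (b i) (T i) := by
  unfold relax
  fun_prop

theorem treeSize_of_mem_iterate_relax_le [DecidableEq α] [DecidableEq V] {E : List (Edge α V)}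
    {b q : V} {w : List (α × Bool)} {n : ℕ} (h : (q, w) ∈ (relax E b)^[n] []) :
    treeSize q ≤ treeSize (b, E) ∧ treeSize w ≤ n * (treeSize (b, E) + 1) + 1 := by
  induction n generalizing q w with
  | zero => exact absurd h List.not_mem_nil
  | succ n ih =>
    rw [Function.iterate_succ_apply'] at h
    obtain heq | ⟨p, a, v, rfl, he, hv, -⟩ := eq_or_exists_of_mem_relax h
    · obtain ⟨rfl, rfl⟩ := Prod.mk.inj heq
      exact ⟨treeSize_fst_le (q, E), Nat.le_add_left _ _⟩
    · have hE : treeSize E ≤ treeSize (b, E) := treeSize_snd_le (b, E)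
      obtain ⟨-, ha, hq⟩ := treeSize_edge_le he
      have ha_le : treeSize a ≤ treeSize (b, E) := ha.trans hE
      have hv_le := (ih hv).2
      rw [treeSize_cons, add_mul]
      exact ⟨hq.trans hE, by omega⟩

theorem treeSize_iterate_relax_le [DecidableEq α] [DecidableEq V] (E : List (Edge α V)) (b : V)
    {n : ℕ} (hn : n ≤ E.length + 1) : treeSize ((relax E b)^[n] []) ≤
      treeSize (b, E) * (treeSize (b, E) + (treeSize (b, E) * (treeSize (b, E) + 1) + 1) + 1 + 1)
        + 1 := by
  have hlength : E.length + 1 ≤ treeSize (b, E) :=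
    Nat.succ_le_of_lt ((length_lt_treeSize E).trans_le (treeSize_snd_le (b, E)))
  have hentries : ∀ x ∈ (relax E b)^[n] [], treeSize x ≤
      treeSize (b, E) + (treeSize (b, E) * (treeSize (b, E) + 1) + 1) + 1 := fun ⟨q, w⟩ hx => by
    obtain ⟨hq, hw⟩ := treeSize_of_mem_iterate_relax_le hx
    rw [treeSize_mk q w]
    gcongr
    exact hw.trans (by gcongr; exact hn.trans hlength)
  refine (treeSize_le_of_forall_mem hentries).trans ?_
  gcongr
  exact (length_iterate_relax_le E b n).trans hlength

@[fun_prop]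
theorem polyTime_shortestWords [DecidableEq α] [DecidableEq V] {E : ι → List (Edge α V)}
    {b : ι → V} (hE : PolyTime E) (hb : PolyTime b) :
    PolyTime fun i => shortestWords (E i) (b i) := by
  unfold shortestWords
  have : PolyBounded fun i => treeSize (b i, E i) := (hb.pair hE).polyBounded_treeSize
  exact PolyTime.nat_iterate (f := fun i => relax (E i) (b i)) (by fun_prop) (by fun_prop)
    (.const []) (B := fun i => treeSize (b i, E i) * (treeSize (b i, E i) +
      (treeSize (b i, E i) * (treeSize (b i, E i) + 1) + 1) + 1 + 1) + 1) (by fun_prop)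
    fun i n hn => treeSize_iterate_relax_le _ _ hn

@[fun_prop]
theorem polyTime_candidates [DecidableEq α] [DecidableEq V] [DecidableEq W]
    {G : ι → V × List (Edge α V)} {G' : ι → W × List (Edge α W)} (hG : PolyTime G)
    (hG' : PolyTime G') : PolyTime fun i => candidates (G i) (G' i) := by
  unfold candidates Diverge
  fun_prop

@[fun_prop]
theorem polyTime_solve {r : ℕ} :
    PolyTime fun x : List (Word r) × List (Word r) => solve x.1 x.2 := by
  unfold solve
  fun_prop

@[fun_prop]
theorem polyTime_encodeAnswer {r : ℕ} :
    PolyTime (encodeAnswer : Option (Word r × Word r) → Data) := by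
  have hpair : PolyTime (TreeEncodable.encode : Word r × Word r → Data) :=
    .of_encode_eq fun _ => rfl
  have helim : PolyTime fun o : Option (Word r × Word r) =>
      o.elim Data.nil TreeEncodable.encode :=
    .option_elim .id (.const _) (hpair.comp (.snd .id))
  exact helim.of_eq fun o => by cases o <;> rfl

theorem treeSize_letter_le {r : ℕ} (a : Fin r × Bool) : treeSize a ≤ 2 * r + 5 := by
  have hgen : treeSize a.1 = 2 * a.1 + 1 := Data.size_ofNat _
  have hsign : treeSize a.2 ≤ 3 := Data.size_ofBool_le _
  have := a.1.isLt
  rw [← Prod.eta a, treeSize_mk]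
  omega

theorem treeSize_words_le {r : ℕ} (L : List (Word r)) :
    treeSize L ≤ (2 * r + 6) * (L.map fun w => w.length + 1).sum + 1 := by
  induction L with
  | nil => exact Nat.le_add_left _ _
  | cons w L ih =>
    have hw := treeSize_le_of_forall_mem fun a (_ : a ∈ w) => treeSize_letter_le a
    rw [treeSize_cons, List.map_cons, List.sum_cons]
    linarith

theorem treeSize_input_le {r : ℕ} (L M : List (Word r)) :
    treeSize (L, M) ≤ (2 * r + 6) * inputSize L M + 3 := by
  have hL := treeSize_words_le L
  have hM := treeSize_words_le M
  rw [inputSize, List.map_append, List.sum_append, mul_add, treeSize_mk]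
  omega

end RunningTime
end SubgroupDistance

theorem mainTheorem9 (r : ℕ) :
    ∃ (c : TreeWhile.Cmd) (p : Polynomial ℕ),
      ∀ L M : List (SubgroupDistance.Word r),
        ∃ (o : Option (SubgroupDistance.Word r × SubgroupDistance.Word r)) (t : ℕ),
          SubgroupDistance.IsAnswer
            (SubgroupDistance.subgroupOf L) (SubgroupDistance.subgroupOf M) o ∧
          TreeWhile.Outputs c (SubgroupDistance.encodeInput L M) t
            (SubgroupDistance.encodeAnswer o) ∧
          t ≤ p.eval (SubgroupDistance.inputSize L M) := by
  obtain ⟨c, p, hc⟩ :=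
    (SubgroupDistance.polyTime_encodeAnswer.comp SubgroupDistance.polyTime_solve).exists_outputs
  refine ⟨c, p.comp (Polynomial.C (2 * r + 6) * Polynomial.X + 3), fun L M => ?_⟩
  obtain ⟨t, ht, hout⟩ := hc (L, M)
  refine ⟨SubgroupDistance.solve L M, t, SubgroupDistance.isAnswer_solve L M, hout, ?_⟩
  calc t ≤ p.eval (TreeWhile.treeSize (L, M)) := ht
    _ ≤ p.eval ((2 * r + 6) * SubgroupDistance.inputSize L M + 3) :=
      TreeWhile.polynomial_eval_mono p (SubgroupDistance.treeSize_input_le L M)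
    _ = _ := by
      simp only [Polynomial.eval_comp, Polynomial.eval_add, Polynomial.eval_mul, Polynomial.eval_C,
        Polynomial.eval_X, Polynomial.eval_ofNat]
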